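/- **Theorem.** Let $(\overline M,\overline g)$ be a smooth $(n+r)$-dimensional Riemannian manifold with Levi-Civita connection $\overline\nabla$, and let $J$ be a smooth $(1,1)$-tensor field on $\overline M$ with $J^2=pJ+qI$ for some positive integers $p,q$ and $\overline g(JX,Y)=\overline g(X,JY)$. Suppose that $(\overline M,\overline g,J)$ is a locally metallic Riemannian manifold, that is, $\overline\nabla J=0$. Let $i:M\to\overline M$ be an isometric immersion of an $n$-dimensional Riemannian manifold $(M,g)$, so $M$ is a submanifold of codimension $r$. Let $N_1,\dots,N_r$ be a smooth orthonormal frame of the normal bundle $T^\perp M$ over an open set $U\subseteq M$. Define on $U$ the structure $\Sigma=(P,g,u_\alpha,\xi_\alpha,(a_{\alpha\beta})_r)$ induced on $M$ by taking tangential and normal components: $$J(i_*X)=i_*(PX)+\sum_{\alpha}u_\alpha(X)N_\alpha,\qquad J(N_\alpha)=i_*(\xi_\alpha)+\sum_{\beta}a_{\alpha\beta}N_\beta .$$ Define the shape operators $A_\alpha$ and the coefficients $l_{\alpha\beta}$ of the normal connection $\nabla^\perp$ by $$\overline\nabla_XN_\alpha=-i_*(A_\alpha X)+\nabla^\perp_XN_\alpha,\qquad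 \nabla^\perp_XN_\alpha=\sum_\beta l_{\alpha\beta}(X)N_\beta ,$$ and set $B_\alpha=PA_\alpha-A_\alpha P$. Let $$N_P(X,Y)=[PX,PY]+P^2[X,Y]-P[PX,Y]-P[X,PY]$$ be the Nijenhuis torsion of $P$, and let $du_\alpha$ be normalised by $$2\,du_\alpha(X,Y)=X(u_\alpha(Y))-Y(u_\alpha(X))-u_\alpha([X,Y]).$$ Then, at every point of $U$, for all smooth vector fields $X,Y$ on $U$, $$N_P(X,Y)=\sum_{\alpha=1}^r\bigl[g(X,\xi_\alpha)B_\alpha Y-g(Y,\xi_\alpha)B_\alpha X-g(B_\alpha X,Y)\xi_\alpha\bigr],$$ and, for every $\alpha\in\{1,\dots,r\}$, $$2\,du_\alpha(X,Y)=-g(B_\alpha X,Y)+\sum_{\beta=1}^r\bigl[l_{\alpha\beta}(X)g(Y,\xi_\beta)-l_{\alpha\beta}(Y)g(X,\xi_\beta)\bigr].$$ -/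

import Mathlib

open Bundle Manifold Module
open scoped ContDiff

noncomputable section

namespace MetallicSubmanifold

/-! ### Notions on one Riemannian manifold -/

section OneManifold

variable {E : Type*} [NormedAddCommGroup E] [NormedSpace ℝ E]
  {M : Type*} [TopologicalSpace M] [ChartedSpace E M]

/-- The type of (rough) vector fields on `M`. -/
abbrev VField (E : Type*) [NormedAddCommGroup E] [NormedSpace ℝ E]
    (M : Type*) [TopologicalSpace M] [ChartedSpace E M] :=
  Π x : M, TangentSpace 𝓘(ℝ, E) x

/-- The type of (rough) `(1,1)`-tensor fields on `M`, seen as fields of endomorphisms. -/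
abbrev EndField (E : Type*) [NormedAddCommGroup E] [NormedSpace ℝ E]
    (M : Type*) [TopologicalSpace M] [ChartedSpace E M] :=
  Π x : M, TangentSpace 𝓘(ℝ, E) x →L[ℝ] TangentSpace 𝓘(ℝ, E) x

/-- The vector field `X` is smooth on the set `U`. -/
def SmoothVFieldOn [IsManifold 𝓘(ℝ, E) ∞ M] (X : VField E M) (U : Set M) : Prop :=
  ContMDiffOn 𝓘(ℝ, E) 𝓘(ℝ, E).tangent ∞ (fun x ↦ (⟨x, X x⟩ : TangentBundle 𝓘(ℝ, E) M)) U

/-- The `(1,1)`-tensor field `J` is smooth, as a section of the bundle `Hom(TM, TM)`. -/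
def SmoothEndField [IsManifold 𝓘(ℝ, E) ∞ M] (J : EndField E M) : Prop :=
  ContMDiff 𝓘(ℝ, E) (𝓘(ℝ, E).prod 𝓘(ℝ, E →L[ℝ] E)) ∞
    (fun x ↦ TotalSpace.mk' (E →L[ℝ] E)
      (E := fun y : M ↦ TangentSpace 𝓘(ℝ, E) y →L[ℝ] TangentSpace 𝓘(ℝ, E) y) x (J x))

/-- The Nijenhuis torsion
`N_P(X, Y) = [PX, PY] + P²[X, Y] - P[PX, Y] - P[X, PY]`, evaluated at the point `x`. -/
def nijenhuis (P : EndField E M) (X Y : VField E M) (x : M) : TangentSpace 𝓘(ℝ, E) x :=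
  VectorField.mlieBracket 𝓘(ℝ, E) (fun y ↦ P y (X y)) (fun y ↦ P y (Y y)) x
    + P x (P x (VectorField.mlieBracket 𝓘(ℝ, E) X Y x))
    - P x (VectorField.mlieBracket 𝓘(ℝ, E) (fun y ↦ P y (X y)) Y x)
    - P x (VectorField.mlieBracket 𝓘(ℝ, E) X (fun y ↦ P y (Y y)) x)

/-- The exterior derivative of a `1`-form `u`, with the normalisation
`2 du(X, Y) = X(u(Y)) - Y(u(X)) - u([X, Y])`, evaluated at the point `x`. -/
def extDer (u : Π x : M, TangentSpace 𝓘(ℝ, E) x →L[ℝ] ℝ) (X Y : VField E M) (x : M) : ℝ :=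
  (1 / 2 : ℝ) *
    (mvfderiv 𝓘(ℝ, E) (fun y ↦ u y (Y y)) x (X x)
      - mvfderiv 𝓘(ℝ, E) (fun y ↦ u y (X y)) x (Y x)
      - u x (VectorField.mlieBracket 𝓘(ℝ, E) X Y x))

variable [FiniteDimensional ℝ E] [IsManifold 𝓘(ℝ, E) ∞ M]
  [RiemannianBundle (fun x : M ↦ TangentSpace 𝓘(ℝ, E) x)]
  [IsContMDiffRiemannianBundle 𝓘(ℝ, E) ∞ E (fun x : M ↦ TangentSpace 𝓘(ℝ, E) x)]

/-- `∇` is the Levi-Civita connection of the Riemannian manifold `M`: it is torsion-free and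
compatible with the metric. -/
structure IsLeviCivita
    (cov : CovariantDerivative 𝓘(ℝ, E) E (fun x : M ↦ TangentSpace 𝓘(ℝ, E) x)) : Prop where
  torsion_eq_zero : cov.torsion = 0
  metric : ∀ (Y Z : VField E M) (x : M),
    MDifferentiableAt 𝓘(ℝ, E) 𝓘(ℝ, E).tangent
      (fun y ↦ (⟨y, Y y⟩ : TangentBundle 𝓘(ℝ, E) M)) x →
    MDifferentiableAt 𝓘(ℝ, E) 𝓘(ℝ, E).tangent
      (fun y ↦ (⟨y, Z y⟩ : TangentBundle 𝓘(ℝ, E) M)) x →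
    ∀ v : TangentSpace 𝓘(ℝ, E) x,
      mvfderiv 𝓘(ℝ, E) (fun y ↦ inner ℝ (Y y) (Z y)) x v
        = inner ℝ (cov Y x v) (Z x) + inner ℝ (Y x) (cov Z x v)

/-- `(g, J)` is a metallic Riemannian structure with parameters `p, q` on the Riemannian manifold
`M`: `J` is a `(1,1)`-tensor field with `J² = pJ + qI`, and the metric is `J`-compatible. -/
structure IsMetallicRiemannian (p q : ℕ) (J : EndField E M) : Prop where
  p_pos : 0 < p
  q_pos : 0 < q
  smooth : SmoothEndField J
  sq : ∀ (x : M) (v : TangentSpace 𝓘(ℝ, E) x), J x (J x v) = (p : ℝ) • J x v + (q : ℝ) • v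
  compat : ∀ (x : M) (v w : TangentSpace 𝓘(ℝ, E) x), inner ℝ (J x v) w = inner ℝ v (J x w)

/-- The `(1,1)`-tensor field `J` is parallel: `(∇_X J)Y = ∇_X (JY) - J(∇_X Y) = 0`. -/
def IsParallel (cov : CovariantDerivative 𝓘(ℝ, E) E (fun x : M ↦ TangentSpace 𝓘(ℝ, E) x))
    (J : EndField E M) : Prop :=
  ∀ (Y : VField E M) (x : M),
    MDifferentiableAt 𝓘(ℝ, E) 𝓘(ℝ, E).tangent
      (fun y ↦ (⟨y, Y y⟩ : TangentBundle 𝓘(ℝ, E) M)) x →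
    ∀ v : TangentSpace 𝓘(ℝ, E) x, cov (fun y ↦ J y (Y y)) x v = J x (cov Y x v)

end OneManifold

/-! ### Submanifolds -/

section Submanifold

variable {E : Type*} [NormedAddCommGroup E] [NormedSpace ℝ E] [FiniteDimensional ℝ E]
  {M : Type*} [TopologicalSpace M] [ChartedSpace E M] [IsManifold 𝓘(ℝ, E) ∞ M]
  [RiemannianBundle (fun x : M ↦ TangentSpace 𝓘(ℝ, E) x)]
  {E' : Type*} [NormedAddCommGroup E'] [NormedSpace ℝ E'] [FiniteDimensional ℝ E']
  {M' : Type*} [TopologicalSpace M'] [ChartedSpace E' M'] [IsManifold 𝓘(ℝ, E') ∞ M']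
  [RiemannianBundle (fun x : M' ↦ TangentSpace 𝓘(ℝ, E') x)]

/-- The differential `i_* : T_x M → T_{i(x)} M'`. -/
abbrev push (i : M → M') (x : M) :
    TangentSpace 𝓘(ℝ, E) x →L[ℝ] TangentSpace 𝓘(ℝ, E') (i x) :=
  mfderiv 𝓘(ℝ, E) 𝓘(ℝ, E') i x

/-- `i : M → M'` is an isometric immersion: it is smooth and `g(X, Y) = g'(i_* X, i_* Y)`
(so that `i_*` is injective at each point). -/
structure IsIsometricImmersion (E : Type*) [NormedAddCommGroup E] [NormedSpace ℝ E]
    {M : Type*} [TopologicalSpace M] [ChartedSpace E M]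
    [RiemannianBundle (fun x : M ↦ TangentSpace 𝓘(ℝ, E) x)]
    (E' : Type*) [NormedAddCommGroup E'] [NormedSpace ℝ E']
    {M' : Type*} [TopologicalSpace M'] [ChartedSpace E' M']
    [RiemannianBundle (fun x : M' ↦ TangentSpace 𝓘(ℝ, E') x)] (i : M → M') : Prop where
  smooth : ContMDiff 𝓘(ℝ, E) 𝓘(ℝ, E') ∞ i
  isometric : ∀ (x : M) (v w : TangentSpace 𝓘(ℝ, E) x),
    inner ℝ (push (E := E) (E' := E') i x v) (push (E := E) (E' := E') i x w) = inner ℝ v w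

/-- The (rough) vector fields along `i`. -/
abbrev VFieldAlong (E' : Type*) [NormedAddCommGroup E'] [NormedSpace ℝ E']
    {M M' : Type*} [TopologicalSpace M'] [ChartedSpace E' M'] (i : M → M') :=
  Π x : M, TangentSpace 𝓘(ℝ, E') (i x)

/-- `ν_1, …, ν_r` is a smooth orthonormal frame, on the open set `U`, of the normal spaces of the
submanifold. (It spans them when the codimension is `r`.) -/
structure IsNormalFrame (E : Type*) [NormedAddCommGroup E] [NormedSpace ℝ E]
    {M : Type*} [TopologicalSpace M] [ChartedSpace E M] {r : ℕ} (i : M → M') (U : Set M) (ν : Fin r → VFieldAlong E' i) :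
    Prop where
  isOpen : IsOpen U
  smooth : ∀ α, ContMDiffOn 𝓘(ℝ, E) 𝓘(ℝ, E').tangent ∞
    (fun x ↦ (⟨i x, ν α x⟩ : TangentBundle 𝓘(ℝ, E') M')) U
  normal : ∀ α, ∀ x ∈ U, ∀ v : TangentSpace 𝓘(ℝ, E) x, inner ℝ (ν α x) (push i x v) = 0
  orthonormal : ∀ α β, ∀ x ∈ U, inner ℝ (ν α x) (ν β x) = if α = β then (1 : ℝ) else 0

/-- The tangential component, seen in `T_x M`, of a vector `w ∈ T_{i(x)} M'`: the vector `v` with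
`g(v, X) = g'(w, i_* X)` for all `X ∈ T_x M`, that is, the image of `w` under the adjoint of `i_*`.
For an isometric immersion, `i_* v` is the orthogonal projection of `w` on `i_*(T_x M)`. -/
def tangentPart (i : M → M') (x : M) :
    TangentSpace 𝓘(ℝ, E') (i x) →L[ℝ] TangentSpace 𝓘(ℝ, E) x :=
  haveI : FiniteDimensional ℝ (TangentSpace 𝓘(ℝ, E) x) := ‹FiniteDimensional ℝ E›
  haveI : FiniteDimensional ℝ (TangentSpace 𝓘(ℝ, E') (i x)) := ‹FiniteDimensional ℝ E'›
  haveI : CompleteSpace (TangentSpace 𝓘(ℝ, E) x) := FiniteDimensional.complete ℝ _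
  haveI : CompleteSpace (TangentSpace 𝓘(ℝ, E') (i x)) := FiniteDimensional.complete ℝ _
  ContinuousLinearMap.adjoint (push i x)

/-- The normal component of a vector `w ∈ T_{i(x)} M'`. -/
def normalPart (E : Type*) [NormedAddCommGroup E] [NormedSpace ℝ E] [FiniteDimensional ℝ E]
    {M : Type*} [TopologicalSpace M] [ChartedSpace E M] [IsManifold 𝓘(ℝ, E) ∞ M]
    [RiemannianBundle (fun x : M ↦ TangentSpace 𝓘(ℝ, E) x)] (i : M → M') (x : M) :
    TangentSpace 𝓘(ℝ, E') (i x) →L[ℝ] TangentSpace 𝓘(ℝ, E') (i x) :=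
  ContinuousLinearMap.id ℝ _ - (push (E := E) i x).comp (tangentPart i x)

/-! #### The induced structure `(P, g, u_α, ξ_α, (a_αβ))` -/

/-- `P X` is the tangential component of `J (i_* X)`. -/
def inducedP (J : EndField E' M') (i : M → M') : EndField E M :=
  fun x ↦ (tangentPart i x).comp ((J (i x)).comp (push i x))

/-- `u_α(X)` is the component of `J (i_* X)` along `ν_α`. -/
def inducedU {r : ℕ} (J : EndField E' M') (i : M → M') (ν : Fin r → VFieldAlong E' i) (α : Fin r)
    (x : M) : TangentSpace 𝓘(ℝ, E) x →L[ℝ] ℝ :=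
  (innerSL ℝ (ν α x)).comp ((J (i x)).comp (push i x))

/-- `ξ_α` is the tangential component of `J ν_α`. -/
def inducedXi {r : ℕ} (J : EndField E' M') (i : M → M') (ν : Fin r → VFieldAlong E' i)
    (α : Fin r) : VField E M :=
  fun x ↦ tangentPart i x (J (i x) (ν α x))

/-- `a_αβ` is the component of `J ν_α` along `ν_β`. -/
def inducedA {r : ℕ} (J : EndField E' M') (i : M → M') (ν : Fin r → VFieldAlong E' i)
    (α β : Fin r) (x : M) : ℝ :=
  inner ℝ (J (i x) (ν α x)) (ν β x)

/-! #### The connection along the immersion, the shape operators and the normal connection -/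

/-- The covariant derivative `X ↦ ∇'_X V`, at `x`, of a vector field `V` along `i`, for a connection
`∇'` on `M'` (the pullback connection). In the trivialization `t` of `TM'` around `i(x)`, write
`V` as an `E'`-valued function; then
`∇'_X V = (dV)(X) + ∇'_{i_* X} W`, where `W` is the vector field on `M'` with value `V(x)` at
`i(x)` and constant components in `t`. -/
def covAlong (cov : CovariantDerivative 𝓘(ℝ, E') E' (fun y : M' ↦ TangentSpace 𝓘(ℝ, E') y))
    (i : M → M') (V : VFieldAlong E' i) (x : M) :
    TangentSpace 𝓘(ℝ, E) x →L[ℝ] TangentSpace 𝓘(ℝ, E') (i x) :=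
  ((trivializationAt E' (TangentSpace 𝓘(ℝ, E')) (i x)).symmL ℝ (i x)).comp
      (mvfderiv 𝓘(ℝ, E)
        (fun y ↦ (trivializationAt E' (TangentSpace 𝓘(ℝ, E')) (i x)
          (⟨i y, V y⟩ : TangentBundle 𝓘(ℝ, E') M')).2) x)
    + (cov (FiberBundle.extend E' (V x)) (i x)).comp (push i x)

/-- The shape operator `A_α`, given by the Weingarten formula
`∇'_X ν_α = - i_*(A_α X) + ∇^⊥_X ν_α`. -/
def shape {r : ℕ} (cov : CovariantDerivative 𝓘(ℝ, E') E' (fun y : M' ↦ TangentSpace 𝓘(ℝ, E') y))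
    (i : M → M') (ν : Fin r → VFieldAlong E' i) (α : Fin r) : EndField E M :=
  fun x ↦ -((tangentPart i x).comp (covAlong cov i (ν α) x))

/-- The normal connection: `∇^⊥_X V` is the normal component of `∇'_X V`. -/
def normalCov (cov : CovariantDerivative 𝓘(ℝ, E') E' (fun y : M' ↦ TangentSpace 𝓘(ℝ, E') y))
    (i : M → M') (V : VFieldAlong E' i) (x : M) :
    TangentSpace 𝓘(ℝ, E) x →L[ℝ] TangentSpace 𝓘(ℝ, E') (i x) :=
  (normalPart E i x).comp (covAlong cov i V x)

/-- The coefficients `l_αβ` of the normal connection, `∇^⊥_X ν_α = ∑_β l_αβ(X) ν_β`. -/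
def normalCoeff {r : ℕ}
    (cov : CovariantDerivative 𝓘(ℝ, E') E' (fun y : M' ↦ TangentSpace 𝓘(ℝ, E') y))
    (i : M → M') (ν : Fin r → VFieldAlong E' i) (α β : Fin r) (x : M) :
    TangentSpace 𝓘(ℝ, E) x →L[ℝ] ℝ :=
  (innerSL ℝ (ν β x)).comp (normalCov cov i (ν α) x)

/-- `B_α = P A_α - A_α P`. -/
def opB {r : ℕ} (cov : CovariantDerivative 𝓘(ℝ, E') E' (fun y : M' ↦ TangentSpace 𝓘(ℝ, E') y))
    (J : EndField E' M') (i : M → M') (ν : Fin r → VFieldAlong E' i) (α : Fin r) : EndField E M :=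
  fun x ↦ (inducedP J i x).comp (shape cov i ν α x) - (shape cov i ν α x).comp (inducedP J i x)

end Submanifold

/-! ### The defining decompositions -/

section Decompositions

variable {E : Type*} [NormedAddCommGroup E] [NormedSpace ℝ E] [FiniteDimensional ℝ E]
  {M : Type*} [TopologicalSpace M] [ChartedSpace E M] [IsManifold 𝓘(ℝ, E) ∞ M]
  [RiemannianBundle (fun x : M ↦ TangentSpace 𝓘(ℝ, E) x)]
  {E' : Type*} [NormedAddCommGroup E'] [NormedSpace ℝ E'] [FiniteDimensional ℝ E']
  {M' : Type*} [TopologicalSpace M'] [ChartedSpace E' M'] [IsManifold 𝓘(ℝ, E') ∞ M']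
  [RiemannianBundle (fun x : M' ↦ TangentSpace 𝓘(ℝ, E') x)]

set_option linter.unusedSectionVars false

theorem inner_tangentPart (i : M → M') (x : M) (w : TangentSpace 𝓘(ℝ, E') (i x))
    (v : TangentSpace 𝓘(ℝ, E) x) :
    inner ℝ (tangentPart i x w) v = inner ℝ w (push i x v) := by
  have : FiniteDimensional ℝ (TangentSpace 𝓘(ℝ, E) x) := ‹FiniteDimensional ℝ E›
  have : FiniteDimensional ℝ (TangentSpace 𝓘(ℝ, E') (i x)) := ‹FiniteDimensional ℝ E'›
  have : CompleteSpace (TangentSpace 𝓘(ℝ, E) x) := FiniteDimensional.complete ℝ _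
  have : CompleteSpace (TangentSpace 𝓘(ℝ, E') (i x)) := FiniteDimensional.complete ℝ _
  exact ContinuousLinearMap.adjoint_inner_left _ _ _

/-- Every vector `w` at a point of the submanifold is the sum of its tangential component and of its
components along the normal frame. -/
theorem eq_push_tangentPart_add_sum {r : ℕ} (hdim : finrank ℝ E' = finrank ℝ E + r)
    {i : M → M'} (hi : IsIsometricImmersion E E' i) {U : Set M} {ν : Fin r → VFieldAlong E' i}
    (hν : IsNormalFrame E i U ν) {x : M} (hx : x ∈ U) (w : TangentSpace 𝓘(ℝ, E') (i x)) :
    w = push i x (tangentPart (E := E) i x w) + ∑ α, (inner ℝ w (ν α x) : ℝ) • ν α x := by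
  have : FiniteDimensional ℝ (TangentSpace 𝓘(ℝ, E) x) := ‹FiniteDimensional ℝ E›
  have : FiniteDimensional ℝ (TangentSpace 𝓘(ℝ, E') (i x)) := ‹FiniteDimensional ℝ E'›
  let L : (TangentSpace 𝓘(ℝ, E) x × (Fin r → ℝ)) →ₗ[ℝ] TangentSpace 𝓘(ℝ, E') (i x) :=
    (push i x).toLinearMap.coprod (Fintype.linearCombination ℝ (fun α ↦ ν α x))
  have hL : ∀ v c, L (v, c) = push i x v + ∑ α, c α • ν α x := by
    intro v c; simp [L, Fintype.linearCombination_apply]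
  have h1 : ∀ v c (u : TangentSpace 𝓘(ℝ, E) x), inner ℝ (L (v, c)) (push i x u) = inner ℝ v u := by
    intro v c u
    rw [hL, inner_add_left, hi.isometric, sum_inner]
    simp [inner_smul_left, hν.normal _ x hx]
  have h2 : ∀ v c β, inner ℝ (L (v, c)) (ν β x) = c β := by
    intro v c β
    rw [hL, inner_add_left, real_inner_comm, hν.normal _ x hx, sum_inner]
    simp [inner_smul_left, hν.orthonormal _ _ x hx]
  have hinj : Function.Injective L := by
    rw [← LinearMap.ker_eq_bot, LinearMap.ker_eq_bot']
    rintro ⟨v, c⟩ h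
    have hv : v = 0 := by
      have := h1 v c v
      rw [h, inner_zero_left] at this
      exact inner_self_eq_zero.1 this.symm
    have hc : c = 0 := by
      ext β
      have := h2 v c β
      rw [h, inner_zero_left] at this
      exact this.symm
    rw [hv, hc]; rfl
  have hsurj : Function.Surjective L := by
    refine (LinearMap.injective_iff_surjective_of_finrank_eq_finrank ?_).1 hinj
    rw [Module.finrank_prod, Module.finrank_fin_fun]
    exact hdim.symm
  obtain ⟨⟨v, c⟩, rfl⟩ := hsurj w
  have hv : tangentPart (E := E) i x (L (v, c)) = v := by
    refine ext_inner_right ℝ fun u ↦ ?_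
    rw [inner_tangentPart, h1]
  simp only [h2, hv]
  exact hL v c

/-- `J (i_* X) = i_* (P X) + ∑_α u_α(X) ν_α`. -/
theorem decomposition_push {r : ℕ} (hdim : finrank ℝ E' = finrank ℝ E + r)
    {i : M → M'} (hi : IsIsometricImmersion E E' i) {U : Set M} {ν : Fin r → VFieldAlong E' i}
    (hν : IsNormalFrame E i U ν) (J : EndField E' M') {x : M} (hx : x ∈ U)
    (v : TangentSpace 𝓘(ℝ, E) x) :
    J (i x) (push i x v)
      = push i x (inducedP J i x v) + ∑ α, inducedU J i ν α x v • ν α x := by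
  refine (eq_push_tangentPart_add_sum hdim hi hν hx _).trans ?_
  simp only [inducedP, inducedU, ContinuousLinearMap.comp_apply, innerSL_apply_apply]
  congr 1
  exact Finset.sum_congr rfl fun α _ ↦ by rw [real_inner_comm]

/-- `J ν_α = i_* ξ_α + ∑_β a_αβ ν_β`. -/
theorem decomposition_normal {r : ℕ} (hdim : finrank ℝ E' = finrank ℝ E + r)
    {i : M → M'} (hi : IsIsometricImmersion E E' i) {U : Set M} {ν : Fin r → VFieldAlong E' i}
    (hν : IsNormalFrame E i U ν) (J : EndField E' M') {x : M} (hx : x ∈ U) (α : Fin r) :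
    J (i x) (ν α x)
      = push (E := E) i x (inducedXi J i ν α x) + ∑ β, inducedA J i ν α β x • ν β x :=
  eq_push_tangentPart_add_sum hdim hi hν hx _

/-- `∇'_X ν_α = - i_*(A_α X) + ∑_β l_αβ(X) ν_β`. -/
theorem weingarten {r : ℕ} (hdim : finrank ℝ E' = finrank ℝ E + r)
    {i : M → M'} (hi : IsIsometricImmersion E E' i) {U : Set M} {ν : Fin r → VFieldAlong E' i}
    (hν : IsNormalFrame E i U ν)
    (cov : CovariantDerivative 𝓘(ℝ, E') E' (fun y : M' ↦ TangentSpace 𝓘(ℝ, E') y))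
    {x : M} (hx : x ∈ U) (α : Fin r) (v : TangentSpace 𝓘(ℝ, E) x) :
    covAlong cov i (ν α) x v
      = -push i x (shape cov i ν α x v) + ∑ β, normalCoeff cov i ν α β x v • ν β x := by
  refine (eq_push_tangentPart_add_sum (E := E) hdim hi hν hx _).trans ?_
  congr 1
  · simp [shape]
  · refine Finset.sum_congr rfl fun β _ ↦ ?_
    congr 1
    simp only [normalCoeff, normalCov, normalPart, ContinuousLinearMap.comp_apply,
      innerSL_apply_apply, sub_apply, inner_sub_right,
      ContinuousLinearMap.id_apply, hν.normal _ x hx, sub_zero]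
    rw [real_inner_comm]

theorem mvfderiv_congr {f g : M → E'} {x : M} (h : f =ᶠ[nhds x] g) :
    mvfderiv 𝓘(ℝ, E) f x = mvfderiv 𝓘(ℝ, E) g x := by
  ext v
  have := h.mfderiv_eq (I := 𝓘(ℝ, E)) (I' := 𝓘(ℝ, E'))
  exact congrArg (fun L : TangentSpace 𝓘(ℝ, E) x →L[ℝ] E' ↦ L v) this

/-- In the trivialization of `TM'` around `y`, a vector field is differentiated by differentiating
its components and adding the derivative of the field with constant components. -/
theorem cov_eq_deriv_add
    (cov : CovariantDerivative 𝓘(ℝ, E') E' (fun y : M' ↦ TangentSpace 𝓘(ℝ, E') y))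
    (y : M') (W : VField E' M')
    (hW : MDifferentiableAt 𝓘(ℝ, E') 𝓘(ℝ, E').tangent
      (fun z ↦ (⟨z, W z⟩ : TangentBundle 𝓘(ℝ, E') M')) y) :
    cov W y = ((trivializationAt E' (TangentSpace 𝓘(ℝ, E')) y).symmL ℝ y).comp
        (mvfderiv 𝓘(ℝ, E') (fun z ↦ (trivializationAt E' (TangentSpace 𝓘(ℝ, E')) y
          (⟨z, W z⟩ : TangentBundle 𝓘(ℝ, E') M')).2) y)
      + cov (FiberBundle.extend E' (W y)) y := by
  set t := trivializationAt E' (TangentSpace 𝓘(ℝ, E') : M' → Type _) y with ht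
  have hy : y ∈ t.baseSet := FiberBundle.mem_baseSet_trivializationAt' y
  have hnhds : ∀ᶠ z in nhds y, z ∈ t.baseSet := t.open_baseSet.mem_nhds hy
  have hdiff : ∀ V : VField E' M', MDifferentiableAt 𝓘(ℝ, E') 𝓘(ℝ, E').tangent
      (fun z ↦ (⟨z, V z⟩ : TangentBundle 𝓘(ℝ, E') M')) y →
      MDifferentiableAt 𝓘(ℝ, E') 𝓘(ℝ, E')
        (fun z ↦ (t (⟨z, V z⟩ : TangentBundle 𝓘(ℝ, E') M')).2) y := fun V hV ↦
    (mdifferentiableAt_section (IB := 𝓘(ℝ, E')) (F := E')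
      (E := (TangentSpace 𝓘(ℝ, E') : M' → Type _)) V).1 hV
  let Φ : VField E' M' → (TangentSpace 𝓘(ℝ, E') y →L[ℝ] TangentSpace 𝓘(ℝ, E') y) := fun V ↦
    cov V y - (t.symmL ℝ y).comp
        (mvfderiv 𝓘(ℝ, E') (fun z ↦ (t (⟨z, V z⟩ : TangentBundle 𝓘(ℝ, E') M')).2) y)
  have hΦ : TensorialAt 𝓘(ℝ, E') E' Φ y := by
    constructor
    · intro f σ hf hσ
      have e : (fun z ↦ (t (⟨z, (f • σ) z⟩ : TangentBundle 𝓘(ℝ, E') M')).2) =ᶠ[nhds y]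
          f • (fun z ↦ (t (⟨z, σ z⟩ : TangentBundle 𝓘(ℝ, E') M')).2) := by
        filter_upwards [hnhds] with z hz
        exact (t.linear ℝ hz).2 _ _
      have hs : t.symmL ℝ y (t ⟨y, σ y⟩).2 = σ y :=
        (t.symmL_apply hy _).trans (t.symm_apply_apply_mk hy (σ y))
      simp only [Φ]
      rw [cov.isCovariantDerivativeOnUniv.leibniz hσ hf, mvfderiv_congr e,
        mvfderiv_smul hf (hdiff σ hσ)]
      ext v
      simp [hs]
      module
    · intro σ σ' hσ hσ'
      have e : (fun z ↦ (t (⟨z, (σ + σ') z⟩ : TangentBundle 𝓘(ℝ, E') M')).2) =ᶠ[nhds y]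
          (fun z ↦ (t (⟨z, σ z⟩ : TangentBundle 𝓘(ℝ, E') M')).2) +
          (fun z ↦ (t (⟨z, σ' z⟩ : TangentBundle 𝓘(ℝ, E') M')).2) := by
        filter_upwards [hnhds] with z hz
        exact (t.linear ℝ hz).1 _ _
      simp only [Φ]
      rw [cov.isCovariantDerivativeOnUniv.add hσ hσ', mvfderiv_congr e,
        mvfderiv_add (hdiff σ hσ) (hdiff σ' hσ')]
      ext v
      simp
      module
  have key := hΦ.pointwise hW (FiberBundle.mdifferentiableAt_extend 𝓘(ℝ, E') E' (W y))
    (FiberBundle.extend_apply_self _ _).symm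
  have e : (fun z ↦ (t (⟨z, FiberBundle.extend E' (W y) z⟩ : TangentBundle 𝓘(ℝ, E') M')).2)
      =ᶠ[nhds y] fun _ ↦ (t ⟨y, W y⟩).2 := by
    filter_upwards [hnhds] with z hz
    simp [FiberBundle.extend, ← ht, hz]
  simp only [Φ] at key
  rw [mvfderiv_congr e, mvfderiv_const, ContinuousLinearMap.comp_zero, sub_zero] at key
  rw [← key]
  abel

/-- For the restriction to `M` of a vector field `W` on `M'`: `∇'_X (W ∘ i) = ∇'_{i_* X} W`. -/
theorem covAlong_comp
    (cov : CovariantDerivative 𝓘(ℝ, E') E' (fun y : M' ↦ TangentSpace 𝓘(ℝ, E') y))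
    {i : M → M'} {x : M} (hi : MDifferentiableAt 𝓘(ℝ, E) 𝓘(ℝ, E') i x) (W : VField E' M')
    (hW : MDifferentiableAt 𝓘(ℝ, E') 𝓘(ℝ, E').tangent
      (fun y ↦ (⟨y, W y⟩ : TangentBundle 𝓘(ℝ, E') M')) (i x)) (v : TangentSpace 𝓘(ℝ, E) x) :
    covAlong cov i (fun y ↦ W (i y)) x v = cov W (i x) (push i x v) := by
  have hd := (mdifferentiableAt_section (IB := 𝓘(ℝ, E')) (F := E')
      (E := (TangentSpace 𝓘(ℝ, E') : M' → Type _)) W).1 hW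
  rw [cov_eq_deriv_add cov (i x) W hW]
  simp only [covAlong, add_apply, ContinuousLinearMap.comp_apply]
  congr 2
  have := mfderiv_comp x hd hi
  exact congrArg (fun L : TangentSpace 𝓘(ℝ, E) x →L[ℝ] E' ↦ L v) this

end Decompositions

end MetallicSubmanifold
end

/-! Write ∇' for the connection of the ambient manifold, pulled back along `i`, and N_α for the
frame. Everything comes from differentiating J(i_*V) = i_*(PV) + ∑ u_α(V) N_α in a direction v
(`map_covAlong_push`). As ∇'J = 0, J passes through ∇'_v. The Gauss formula ∇'_v(i_*V) = i_*(∇_v V)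
+ ∑ g(A_α v, V) N_α and the Weingarten formula then split the result in two. Tangential part
(`inducedCov_inducedP`): (∇_v P)V = ∑ g(A_α v, V) ξ_α + g(V, ξ_α) A_α v. Normal part
(`mvfderiv_inducedU`): v(u_β(V)) = u_β(∇_v V) + ∑ g(A_α v, V) a_αβ − g(A_β v, PV) + ∑ l_βα(v) g(V,
ξ_α).

The tangential projection ∇ is torsion-free, so N_P(X,Y) = (∇_{PX}P)Y − (∇_{PY}P)X − P(∇_X P)Y +
P(∇_Y P)X. Substituting the tangential part, the Pξ_α terms cancel because A_α is symmetric, and the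
rest regroups into B_α = PA_α − A_αP because P is symmetric. Antisymmetrising the normal part in X
and Y gives 2 du_α: the a_αβ terms cancel for the same reason.

The analytic groundwork shows that ∇', which is defined through a trivialization, obeys the Leibniz
rule, commutes with J (`covAlong_endField`), is metric (`mvfderiv_inner_along`) and satisfies
∇'_X(i_*Y) − ∇'_Y(i_*X) = i_*[X,Y] (`covAlong_push_sub`). The last fact rests on d(dh) = 0 for h a
chart composed with `i`. The first two reduce to restrictions of ambient fields, which generate all
fields along `i`. -/

noncomputable section

namespace MetallicSubmanifold

/-! ### Second derivatives and d(dh) = 0 -/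

section SecondDerivative

variable {E : Type*} [NormedAddCommGroup E] [NormedSpace ℝ E]
  {M : Type*} [TopologicalSpace M] [ChartedSpace E M]
  {F : Type*} [NormedAddCommGroup F] [NormedSpace ℝ F]
  {G : Type*} [NormedAddCommGroup G] [NormedSpace ℝ G]

theorem mvfderiv_congr_of_eventuallyEq {f g : M → F} {x : M} (h : f =ᶠ[nhds x] g) :
    mvfderiv 𝓘(ℝ, E) f x = mvfderiv 𝓘(ℝ, E) g x := by
  ext v
  exact congrArg (fun L : E →L[ℝ] F ↦ L v) (h.mfderiv_eq (I := 𝓘(ℝ, E)) (I' := 𝓘(ℝ, F)))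

theorem mvfderiv_comp_fderiv {φ : M → G} {f : G → F} {x : M} (hf : DifferentiableAt ℝ f (φ x))
    (hφ : MDifferentiableAt 𝓘(ℝ, E) 𝓘(ℝ, G) φ x) (v : TangentSpace 𝓘(ℝ, E) x) :
    mvfderiv 𝓘(ℝ, E) (f ∘ φ) x v = fderiv ℝ f (φ x) (mvfderiv 𝓘(ℝ, E) φ x v) := by
  have h := mfderiv_comp x hf.mdifferentiableAt hφ
  rw [mfderiv_eq_fderiv] at h
  exact congrArg (fun L : E →L[ℝ] F ↦ L v) h

variable [IsManifold 𝓘(ℝ, E) ∞ M]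

/-- In the chart around `x`, a `C²` function is differentiated through its local expression. -/
theorem eventually_mvfderiv_eq_fderiv_extChartAt {h : M → F} {x : M}
    (hh : ContMDiffAt 𝓘(ℝ, E) 𝓘(ℝ, F) 2 h x) :
    ContDiffAt ℝ 2 (h ∘ (extChartAt 𝓘(ℝ, E) x).symm) (extChartAt 𝓘(ℝ, E) x x) ∧
    ∀ᶠ y in nhds x, ∀ v : TangentSpace 𝓘(ℝ, E) y, mvfderiv 𝓘(ℝ, E) h y v
      = fderiv ℝ (h ∘ (extChartAt 𝓘(ℝ, E) x).symm) (extChartAt 𝓘(ℝ, E) x y)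
        (mvfderiv 𝓘(ℝ, E) (extChartAt 𝓘(ℝ, E) x) y v) := by
  have : IsManifold 𝓘(ℝ, E) 2 M := .of_le (n := ∞) (by exact_mod_cast ENat.LEInfty.out)
  set φ := extChartAt 𝓘(ℝ, E) x with hφ
  let H : E → F := h ∘ φ.symm
  have hH : ContDiffAt ℝ 2 H (φ x) := by
    have := (contMDiffAt_iff_source (I := 𝓘(ℝ, E)) (x := x)).1 hh
    rw [show Set.range 𝓘(ℝ, E) = Set.univ by simp, contMDiffWithinAt_univ,
      contMDiffAt_iff_contDiffAt] at this
    exact this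
  refine ⟨hH, ?_⟩
  have hsrc : φ.source ∈ nhds x := extChartAt_source_mem_nhds x
  -- Being C² at a point, for a finite order, persists nearby; differentiability is needed at all
  -- points near x because the formula is differentiated again.
  have hHd : ∀ᶠ y in nhds x, DifferentiableAt ℝ H (φ y) := by
    refine (continuousAt_extChartAt (I := 𝓘(ℝ, E)) x).eventually ?_
    filter_upwards [hH.eventually (by simp)] with e he using he.differentiableAt two_ne_zero
  filter_upwards [eventually_eventually_nhds.2 hsrc, hHd] with y hy hd v
  have e : h =ᶠ[nhds y] H ∘ φ := by
    filter_upwards [hy] with z hz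
    simp [H, φ.left_inv hz]
  have hφd : MDifferentiableAt 𝓘(ℝ, E) 𝓘(ℝ, E) φ y :=
    mdifferentiableAt_extChartAt (by rw [← extChartAt_source 𝓘(ℝ, E)]; exact mem_of_mem_nhds hy)
  rw [mvfderiv_congr_of_eventuallyEq e, mvfderiv_comp_fderiv hd hφd]

variable [CompleteSpace E]

/-- Cartan's formula `d(dh) = 0` for a `C²` function `h` with values in a vector space. -/
theorem mvfderiv_mlieBracket {h : M → F} {x : M} (hh : ContMDiffAt 𝓘(ℝ, E) 𝓘(ℝ, F) 2 h x)
    {X Y : VField E M}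
    (hX : MDifferentiableAt 𝓘(ℝ, E) 𝓘(ℝ, E).tangent
      (fun y ↦ (⟨y, X y⟩ : TangentBundle 𝓘(ℝ, E) M)) x)
    (hY : MDifferentiableAt 𝓘(ℝ, E) 𝓘(ℝ, E).tangent
      (fun y ↦ (⟨y, Y y⟩ : TangentBundle 𝓘(ℝ, E) M)) x) :
    mvfderiv 𝓘(ℝ, E) h x (VectorField.mlieBracket 𝓘(ℝ, E) X Y x) =
      mvfderiv 𝓘(ℝ, E) (fun y ↦ mvfderiv 𝓘(ℝ, E) h y (Y y)) x (X x)
        - mvfderiv 𝓘(ℝ, E) (fun y ↦ mvfderiv 𝓘(ℝ, E) h y (X y)) x (Y x) := by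
  have : IsManifold 𝓘(ℝ, E) 2 M := .of_le (n := ∞) (by exact_mod_cast ENat.LEInfty.out)
  set φ := extChartAt 𝓘(ℝ, E) x with hφ
  set c : E := φ x with hc
  have hr : Set.range 𝓘(ℝ, E) = Set.univ := by simp
  -- `hat V` is V read in the chart. In these terms the claim is the symmetry of the second
  -- derivative of `H`.
  let hat : VField E M → E → E := fun V ↦
    VectorField.mpullbackWithin 𝓘(ℝ, E) 𝓘(ℝ, E) φ.symm V (Set.range 𝓘(ℝ, E))
  let H : E → F := h ∘ φ.symm
  obtain ⟨hH, hdh⟩ := eventually_mvfderiv_eq_fderiv_extChartAt hh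
  have hdhat : ∀ V : VField E M, MDifferentiableAt 𝓘(ℝ, E) 𝓘(ℝ, E).tangent
      (fun y ↦ (⟨y, V y⟩ : TangentBundle 𝓘(ℝ, E) M)) x → DifferentiableAt ℝ (hat V) c := by
    intro V hV
    have := (mdifferentiableWithinAt_univ.2 hV).differentiableWithinAt_mpullbackWithin_vectorField
    rw [Set.preimage_univ, Set.univ_inter] at this
    have h' : DifferentiableWithinAt ℝ (hat V) (Set.range 𝓘(ℝ, E)) c := this
    rwa [hr, differentiableWithinAt_univ] at h'
  have hxφ : x ∈ φ.source := mem_extChartAt_source x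
  have hsrc : φ.source ∈ nhds x := extChartAt_source_mem_nhds x
  have hdiffφ : ∀ y ∈ φ.source, MDifferentiableAt 𝓘(ℝ, E) 𝓘(ℝ, E) φ y := fun y hy ↦
    mdifferentiableAt_extChartAt (by simpa [hφ] using hy)
  have hdφ : ∀ y ∈ φ.source, ∀ V : VField E M,
      hat V (φ y) = mvfderiv 𝓘(ℝ, E) φ y (V y) := by
    intro y hy V
    -- Pulling back by the inverse chart is pushing forward by the chart, since the two
    -- differentials are mutually inverse.
    let A : E →L[ℝ] E := mfderivWithin 𝓘(ℝ, E) 𝓘(ℝ, E) φ.symm (Set.range 𝓘(ℝ, E)) (φ y)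
    let B : E →L[ℝ] E := mvfderiv 𝓘(ℝ, E) φ y
    have hAB : A.inverse = B := ContinuousLinearMap.inverse_eq
      (mfderivWithin_extChartAt_symm_comp_mfderiv_extChartAt' hy)
      (mfderiv_extChartAt_comp_mfderivWithin_extChartAt_symm' hy)
    have h2 : (V (φ.symm (φ y)) : E) = V y := congrArg (fun z ↦ (V z : E)) (φ.left_inv hy)
    calc hat V (φ y) = A.inverse (V (φ.symm (φ y)) : E) := rfl
      _ = B (V y) := by rw [hAB]; exact congrArg B h2
  have hdV : ∀ V : VField E M, (fun y ↦ mvfderiv 𝓘(ℝ, E) h y (V y)) =ᶠ[nhds x]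
      (fun e ↦ fderiv ℝ H e (hat V e)) ∘ φ := by
    intro V
    filter_upwards [hdh, hsrc] with y hy hy'
    rw [hy, Function.comp_apply, hdφ y hy' V]
  have hfd : DifferentiableAt ℝ (fderiv ℝ H) c :=
    (hH.fderiv_right (m := 1) (by norm_num)).differentiableAt one_ne_zero
  -- Product rule for DH(`hat V`). Under antisymmetrisation the D²H term disappears and the other
  -- becomes DH of the coordinate bracket.
  have key : ∀ V W : VField E M, MDifferentiableAt 𝓘(ℝ, E) 𝓘(ℝ, E).tangent
      (fun y ↦ (⟨y, V y⟩ : TangentBundle 𝓘(ℝ, E) M)) x →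
      mvfderiv 𝓘(ℝ, E) (fun y ↦ mvfderiv 𝓘(ℝ, E) h y (V y)) x (W x) =
        fderiv ℝ (fderiv ℝ H) c (hat W c) (hat V c) + fderiv ℝ H c (fderiv ℝ (hat V) c (hat W c)) := by
    intro V W hV
    have hG := hfd.hasFDerivAt.clm_apply (hdhat V hV).hasFDerivAt
    rw [mvfderiv_congr_of_eventuallyEq (hdV V),
      mvfderiv_comp_fderiv (φ := φ) hG.differentiableAt (hdiffφ x hxφ), hG.fderiv, hdφ x hxφ W]
    exact add_comm _ _
  have hsymm := hH.isSymmSndFDerivAt (by simp) (hat X c) (hat Y c)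
  rw [key Y X hY, key X Y hX, hdh.self_of_nhds, hsymm]
  -- By definition the bracket at x is the coordinate bracket pulled back by dφ_x, and dφ_x is the
  -- identity in the model of the tangent space at x.
  have hbr : mvfderiv 𝓘(ℝ, E) φ x (VectorField.mlieBracket 𝓘(ℝ, E) X Y x)
      = fderiv ℝ (hat Y) c (hat X c) - fderiv ℝ (hat X) c (hat Y c) := by
    let L : E →L[ℝ] E := mvfderiv 𝓘(ℝ, E) φ x
    have h1 : L = ContinuousLinearMap.id ℝ E := mfderiv_extChartAt_self
    have h2 : (VectorField.mlieBracket 𝓘(ℝ, E) X Y x : E)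
      = L.inverse (VectorField.lieBracketWithin ℝ (hat X) (hat Y) (Set.univ ∩ Set.range 𝓘(ℝ, E)) c) := rfl
    rw [h1, ContinuousLinearMap.inverse_id, Set.univ_inter, hr,
      VectorField.lieBracketWithin_univ] at h2
    exact (congrArg L h2).trans
      (congrArg (fun L : E →L[ℝ] E ↦ L (VectorField.lieBracket ℝ (hat X) (hat Y) c)) h1)
  rw [hbr, map_sub]
  abel

end SecondDerivative

/-! ### Vector fields along a map -/

section Along

variable {E : Type*} [NormedAddCommGroup E] [NormedSpace ℝ E]
  {M : Type*} [TopologicalSpace M] [ChartedSpace E M]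
  {E' : Type*} [NormedAddCommGroup E'] [NormedSpace ℝ E']
  {M' : Type*} [TopologicalSpace M'] [ChartedSpace E' M'] [IsManifold 𝓘(ℝ, E') ∞ M']

/-- The vector field `V` along `i` is differentiable at `x`. -/
abbrev MDiffAlongAt (E : Type*) [NormedAddCommGroup E] [NormedSpace ℝ E]
    {M : Type*} [TopologicalSpace M] [ChartedSpace E M]
    (E' : Type*) [NormedAddCommGroup E'] [NormedSpace ℝ E']
    {M' : Type*} [TopologicalSpace M'] [ChartedSpace E' M'] [IsManifold 𝓘(ℝ, E') ∞ M']
    (i : M → M') (V : VFieldAlong E' i) (x : M) : Prop :=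
  MDifferentiableAt 𝓘(ℝ, E) 𝓘(ℝ, E').tangent
    (fun y ↦ (⟨i y, V y⟩ : TangentBundle 𝓘(ℝ, E') M')) x

/-- The components of `V` in the trivialization of `TM'` around `i x`. -/
abbrev alongCoord {M : Type*}
    (E' : Type*) [NormedAddCommGroup E'] [NormedSpace ℝ E']
    {M' : Type*} [TopologicalSpace M'] [ChartedSpace E' M'] [IsManifold 𝓘(ℝ, E') ∞ M']
    (i : M → M') (V : VFieldAlong E' i) (x y : M) : E' :=
  (trivializationAt E' (TangentSpace 𝓘(ℝ, E')) (i x)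
    (⟨i y, V y⟩ : TangentBundle 𝓘(ℝ, E') M')).2

variable {i : M → M'} {V W : VFieldAlong E' i} {x : M}

theorem mdiffAlongAt_iff : MDiffAlongAt E E' i V x ↔
    MDifferentiableAt 𝓘(ℝ, E) 𝓘(ℝ, E') i x ∧
      MDifferentiableAt 𝓘(ℝ, E) 𝓘(ℝ, E') (alongCoord E' i V x) x :=
  mdifferentiableAt_totalSpace 𝓘(ℝ, E') (fun y ↦ (⟨i y, V y⟩ : TangentBundle 𝓘(ℝ, E') M'))

theorem eventually_mem_baseSet (hi : ContinuousAt i x) : ∀ᶠ y in nhds x,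
    i y ∈ (trivializationAt E' (TangentSpace 𝓘(ℝ, E') : M' → Type _) (i x)).baseSet :=
  hi.eventually ((trivializationAt E' (TangentSpace 𝓘(ℝ, E') : M' → Type _)
    (i x)).open_baseSet.mem_nhds (FiberBundle.mem_baseSet_trivializationAt' (i x)))

theorem alongCoord_congr (h : ∀ᶠ y in nhds x, V y = W y) :
    alongCoord E' i V x =ᶠ[nhds x] alongCoord E' i W x := by
  filter_upwards [h] with y hy
  rw [alongCoord, alongCoord, hy]

theorem alongCoord_add (hi : ContinuousAt i x) :
    alongCoord E' i (fun y ↦ V y + W y) x =ᶠ[nhds x] alongCoord E' i V x + alongCoord E' i W x := by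
  filter_upwards [eventually_mem_baseSet (E' := E') hi] with y hy
  exact ((trivializationAt E' (TangentSpace 𝓘(ℝ, E') : M' → Type _) (i x)).linear ℝ hy).1 _ _

theorem alongCoord_smul (f : M → ℝ) (hi : ContinuousAt i x) :
    alongCoord E' i (fun y ↦ f y • V y) x =ᶠ[nhds x] f • alongCoord E' i V x := by
  filter_upwards [eventually_mem_baseSet (E' := E') hi] with y hy
  exact ((trivializationAt E' (TangentSpace 𝓘(ℝ, E') : M' → Type _) (i x)).linear ℝ hy).2 _ _

theorem MDiffAlongAt.congr (hV : MDiffAlongAt E E' i V x) (h : ∀ᶠ y in nhds x, V y = W y) :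
    MDiffAlongAt E E' i W x := by
  rw [mdiffAlongAt_iff] at hV ⊢
  exact ⟨hV.1, hV.2.congr_of_eventuallyEq (alongCoord_congr h).symm⟩

theorem MDiffAlongAt.add (hV : MDiffAlongAt E E' i V x) (hW : MDiffAlongAt E E' i W x) :
    MDiffAlongAt E E' i (fun y ↦ V y + W y) x := by
  rw [mdiffAlongAt_iff] at hV hW ⊢
  exact ⟨hV.1, (hV.2.add hW.2).congr_of_eventuallyEq (alongCoord_add hV.1.continuousAt)⟩

theorem MDiffAlongAt.smul {f : M → ℝ} (hf : MDifferentiableAt 𝓘(ℝ, E) 𝓘(ℝ, ℝ) f x)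
    (hV : MDiffAlongAt E E' i V x) : MDiffAlongAt E E' i (fun y ↦ f y • V y) x := by
  rw [mdiffAlongAt_iff] at hV ⊢
  exact ⟨hV.1, (hf.smul hV.2).congr_of_eventuallyEq (alongCoord_smul f hV.1.continuousAt)⟩

theorem MDiffAlongAt.comp {W : VField E' M'} (hi : MDifferentiableAt 𝓘(ℝ, E) 𝓘(ℝ, E') i x)
    (hW : MDifferentiableAt 𝓘(ℝ, E') 𝓘(ℝ, E').tangent
      (fun y ↦ (⟨y, W y⟩ : TangentBundle 𝓘(ℝ, E') M')) (i x)) :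
    MDiffAlongAt E E' i (fun y ↦ W (i y)) x :=
  MDifferentiableAt.comp x hW hi

theorem MDiffAlongAt.zero (hi : MDifferentiableAt 𝓘(ℝ, E) 𝓘(ℝ, E') i x) :
    MDiffAlongAt E E' i (fun _ ↦ 0) x :=
  MDiffAlongAt.comp (W := fun _ ↦ 0) hi
    (mdifferentiableAt_zeroSection (IB := 𝓘(ℝ, E')) ℝ (TangentSpace 𝓘(ℝ, E') : M' → Type _))

theorem MDiffAlongAt.sum {ι : Type*} (s : Finset ι) {V : ι → VFieldAlong E' i}
    (hi : MDifferentiableAt 𝓘(ℝ, E) 𝓘(ℝ, E') i x) (hV : ∀ k ∈ s, MDiffAlongAt E E' i (V k) x) :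
    MDiffAlongAt E E' i (fun y ↦ ∑ k ∈ s, V k y) x := by
  classical
  induction s using Finset.induction_on with
  | empty => simpa using MDiffAlongAt.zero hi
  | insert k s hk ih =>
    simp only [Finset.sum_insert hk]
    exact (hV k (by simp)).add (ih fun l hl ↦ hV l (by simp [hl]))

/-- Differentiable vector fields along `i` are generated, over the differentiable functions, by
the restrictions of vector fields on `M'`. -/
theorem MDiffAlongAt.induction [FiniteDimensional ℝ E']
    {Q : VFieldAlong E' i → Prop} (hV : MDiffAlongAt E E' i V x)
    (comp : ∀ W : VField E' M', MDifferentiableAt 𝓘(ℝ, E') 𝓘(ℝ, E').tangent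
      (fun y ↦ (⟨y, W y⟩ : TangentBundle 𝓘(ℝ, E') M')) (i x) → Q (fun y ↦ W (i y)))
    (add : ∀ V W, MDiffAlongAt E E' i V x → MDiffAlongAt E E' i W x → Q V → Q W →
      Q (fun y ↦ V y + W y))
    (smul : ∀ (f : M → ℝ) V, MDifferentiableAt 𝓘(ℝ, E) 𝓘(ℝ, ℝ) f x → MDiffAlongAt E E' i V x → Q V →
      Q (fun y ↦ f y • V y))
    (congr : ∀ V W : VFieldAlong E' i, (∀ᶠ y in nhds x, V y = W y) → MDiffAlongAt E E' i V x → Q V →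
      Q W) : Q V := by
  classical
  obtain ⟨hi, hc⟩ := mdiffAlongAt_iff.1 hV
  set t := trivializationAt E' (TangentSpace 𝓘(ℝ, E') : M' → Type _) (i x) with ht
  have hx : i x ∈ t.baseSet := FiberBundle.mem_baseSet_trivializationAt' (i x)
  let b := finBasis ℝ E'
  -- A frame with constant components near `i x`. There V = ∑ c_k (e_k ∘ i), with c_k the components
  -- of V; `congr` is needed because this expansion is only local.
  let e : Fin (finrank ℝ E') → VField E' M' := fun k ↦
    FiberBundle.extend E' (t.symmL ℝ (i x) (b k))
  have he : ∀ k, MDifferentiableAt 𝓘(ℝ, E') 𝓘(ℝ, E').tangent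
      (fun y ↦ (⟨y, e k y⟩ : TangentBundle 𝓘(ℝ, E') M')) (i x) := fun k ↦
    FiberBundle.mdifferentiableAt_extend 𝓘(ℝ, E') E' _
  let c : Fin (finrank ℝ E') → M → ℝ := fun k y ↦ b.coord k (alongCoord E' i V x y)
  have hcd : ∀ k, MDifferentiableAt 𝓘(ℝ, E) 𝓘(ℝ, ℝ) (c k) x := fun k ↦
    (LinearMap.toContinuousLinearMap (b.coord k)).mdifferentiableAt.comp x hc
  have hterm : ∀ k, MDiffAlongAt E E' i (fun y ↦ c k y • e k (i y)) x ∧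
      Q (fun y ↦ c k y • e k (i y)) := fun k ↦
    have h := MDiffAlongAt.comp hi (he k)
    ⟨h.smul (hcd k), smul _ _ (hcd k) h (comp _ (he k))⟩
  have hsum : ∀ s : Finset (Fin (finrank ℝ E')),
      MDiffAlongAt E E' i (fun y ↦ ∑ k ∈ s, c k y • e k (i y)) x ∧
        Q (fun y ↦ ∑ k ∈ s, c k y • e k (i y)) := by
    intro s
    induction s using Finset.induction_on with
    | empty =>
      simp only [Finset.sum_empty]
      exact ⟨.zero hi, comp (fun _ ↦ 0) (mdifferentiableAt_zeroSection (IB := 𝓘(ℝ, E')) ℝ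
        (TangentSpace 𝓘(ℝ, E') : M' → Type _))⟩
    | insert k s hk ih =>
      simp only [Finset.sum_insert hk]
      exact ⟨(hterm k).1.add ih.1, add _ _ (hterm k).1 ih.1 (hterm k).2 ih.2⟩
  refine congr _ _ ?_ (hsum Finset.univ).1 (hsum Finset.univ).2
  filter_upwards [eventually_mem_baseSet (E' := E') hi.continuousAt] with y hy
  have h1 : ∀ k, e k (i y) = t.symmL ℝ (i y) (b k) := by
    intro k
    have h : (t ⟨i x, t.symmL ℝ (i x) (b k)⟩).2 = b k := by
      rw [t.symmL_apply hx, t.apply_mk_symm hx]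
    rw [t.symmL_apply hy]
    exact congrArg (t.symm (i y)) h
  have h2 : ∑ k, c k y • b k = alongCoord E' i V x y := b.sum_repr _
  simp only [h1, ← map_smul, ← map_sum, h2]
  exact (t.symmL_apply hy _).trans (t.symm_apply_apply_mk hy (V y))

end Along

/-! ### The pullback connection: linearity and the Leibniz rule -/

section CovAlong

variable {E : Type*} [NormedAddCommGroup E] [NormedSpace ℝ E]
  {M : Type*} [TopologicalSpace M] [ChartedSpace E M]
  {E' : Type*} [NormedAddCommGroup E'] [NormedSpace ℝ E']
  {M' : Type*} [TopologicalSpace M'] [ChartedSpace E' M'] [IsManifold 𝓘(ℝ, E') ∞ M']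

variable
  (cov : CovariantDerivative 𝓘(ℝ, E') E' (fun y : M' ↦ TangentSpace 𝓘(ℝ, E') y))
  {i : M → M'} {V W : VFieldAlong E' i} {x : M}

/-- The extension has constant components in the trivialization at y, hence is linear in the vector
wherever that trivialization is defined. -/
theorem eventually_extend_add {y : M'} (v w : TangentSpace 𝓘(ℝ, E') y) : ∀ᶠ z in nhds y,
    FiberBundle.extend E' (v + w) z = FiberBundle.extend E' v z + FiberBundle.extend E' w z := by
  set t := trivializationAt E' (TangentSpace 𝓘(ℝ, E') : M' → Type _) y with ht
  have hy : y ∈ t.baseSet := FiberBundle.mem_baseSet_trivializationAt' y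
  filter_upwards [t.open_baseSet.mem_nhds hy] with z hz
  have h : (t ⟨y, v + w⟩).2 = (t ⟨y, v⟩).2 + (t ⟨y, w⟩).2 := (t.linear ℝ hy).1 _ _
  change t.symm z (t ⟨y, v + w⟩).2 = t.symm z (t ⟨y, v⟩).2 + t.symm z (t ⟨y, w⟩).2
  rw [h, ← t.coe_symmₗ (R := ℝ) hz, map_add]

/-- The connection term of `covAlong` sees V only through its value at x, so its additivity in V is
additivity in that value. Locality of the connection makes the agreement near y sufficient. -/
theorem cov_extend_add {y : M'} (v w : TangentSpace 𝓘(ℝ, E') y) :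
    cov (FiberBundle.extend E' (v + w)) y =
      cov (FiberBundle.extend E' v) y + cov (FiberBundle.extend E' w) y := by
  have h : ∀ v : TangentSpace 𝓘(ℝ, E') y, MDifferentiableAt 𝓘(ℝ, E') 𝓘(ℝ, E').tangent
      (fun z ↦ (⟨z, FiberBundle.extend E' v z⟩ : TangentBundle 𝓘(ℝ, E') M')) y := fun v ↦
    FiberBundle.mdifferentiableAt_extend 𝓘(ℝ, E') E' v
  rw [← cov.isCovariantDerivativeOnUniv.add (h v) (h w)]
  exact cov.isCovariantDerivativeOnUniv.congr_of_eventuallyEq (h _) 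
    (MDiffAlongAt.add (i := id) (h v) (h w))
    Filter.univ_mem (eventually_extend_add v w)

theorem eventually_extend_smul {y : M'} (c : ℝ) (v : TangentSpace 𝓘(ℝ, E') y) : ∀ᶠ z in nhds y,
    FiberBundle.extend E' (c • v) z = c • FiberBundle.extend E' v z := by
  set t := trivializationAt E' (TangentSpace 𝓘(ℝ, E') : M' → Type _) y with ht
  have hy : y ∈ t.baseSet := FiberBundle.mem_baseSet_trivializationAt' y
  filter_upwards [t.open_baseSet.mem_nhds hy] with z hz
  have h : (t ⟨y, c • v⟩).2 = c • (t ⟨y, v⟩).2 := (t.linear ℝ hy).2 _ _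
  change t.symm z (t ⟨y, c • v⟩).2 = c • t.symm z (t ⟨y, v⟩).2
  rw [h, ← t.coe_symmₗ (R := ℝ) hz, map_smul]

theorem cov_extend_smul {y : M'} (c : ℝ) (v : TangentSpace 𝓘(ℝ, E') y) :
    cov (FiberBundle.extend E' (c • v)) y = c • cov (FiberBundle.extend E' v) y := by
  have h : ∀ v : TangentSpace 𝓘(ℝ, E') y, MDifferentiableAt 𝓘(ℝ, E') 𝓘(ℝ, E').tangent
      (fun z ↦ (⟨z, FiberBundle.extend E' v z⟩ : TangentBundle 𝓘(ℝ, E') M')) y := fun v ↦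
    FiberBundle.mdifferentiableAt_extend 𝓘(ℝ, E') E' v
  rw [← cov.isCovariantDerivativeOnUniv.smul_const c (h v)]
  exact cov.isCovariantDerivativeOnUniv.congr_of_eventuallyEq (h _)
    (MDiffAlongAt.smul (i := id) mdifferentiableAt_const (h v)) Filter.univ_mem (eventually_extend_smul c v)

theorem covAlong_apply (v : TangentSpace 𝓘(ℝ, E) x) : covAlong cov i V x v =
    (trivializationAt E' (TangentSpace 𝓘(ℝ, E')) (i x)).symmL ℝ (i x)
      (mvfderiv 𝓘(ℝ, E) (alongCoord E' i V x) x v)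
    + cov (FiberBundle.extend E' (V x)) (i x) (push i x v) := rfl

theorem covAlong_congr (h : ∀ᶠ y in nhds x, V y = W y) (v : TangentSpace 𝓘(ℝ, E) x) :
    covAlong cov i V x v = covAlong cov i W x v := by
  rw [covAlong_apply, covAlong_apply, mvfderiv_congr_of_eventuallyEq (alongCoord_congr h),
    h.self_of_nhds]

theorem covAlong_add (hV : MDiffAlongAt E E' i V x) (hW : MDiffAlongAt E E' i W x)
    (v : TangentSpace 𝓘(ℝ, E) x) :
    covAlong cov i (fun y ↦ V y + W y) x v = covAlong cov i V x v + covAlong cov i W x v := by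
  obtain ⟨hi, hVc⟩ := mdiffAlongAt_iff.1 hV
  have hWc := (mdiffAlongAt_iff.1 hW).2
  simp only [covAlong_apply]
  rw [mvfderiv_congr_of_eventuallyEq (alongCoord_add hi.continuousAt), mvfderiv_add hVc hWc,
    cov_extend_add]
  simp only [add_apply, map_add]
  abel

/-- The Leibniz term comes only from differentiating the components; in the connection term f enters
as the constant f(x). -/
theorem covAlong_smul {f : M → ℝ} (hf : MDifferentiableAt 𝓘(ℝ, E) 𝓘(ℝ, ℝ) f x)
    (hV : MDiffAlongAt E E' i V x) (v : TangentSpace 𝓘(ℝ, E) x) :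
    covAlong cov i (fun y ↦ f y • V y) x v =
      mvfderiv 𝓘(ℝ, E) f x v • V x + f x • covAlong cov i V x v := by
  obtain ⟨hi, hVc⟩ := mdiffAlongAt_iff.1 hV
  have hx := FiberBundle.mem_baseSet_trivializationAt' (F := E')
    (E := (TangentSpace 𝓘(ℝ, E') : M' → Type _)) (i x)
  have hs : (trivializationAt E' (TangentSpace 𝓘(ℝ, E')) (i x)).symmL ℝ (i x)
      (alongCoord E' i V x x) = V x :=
    (Trivialization.symmL_apply _ hx _).trans (Trivialization.symm_apply_apply_mk _ hx (V x))
  simp only [covAlong_apply]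
  rw [mvfderiv_congr_of_eventuallyEq (alongCoord_smul f hi.continuousAt), mvfderiv_smul hf hVc,
    cov_extend_smul]
  simp only [add_apply, map_add, smul_apply, map_smul, ContinuousLinearMap.smulRight_apply]
  rw [hs]
  module

theorem covAlong_zero (v : TangentSpace 𝓘(ℝ, E) x)
    (hi : MDifferentiableAt 𝓘(ℝ, E) 𝓘(ℝ, E') i x) :
    covAlong cov i (fun _ ↦ 0) x v = 0 := by
  simpa using covAlong_smul cov (f := fun _ ↦ 0) mdifferentiableAt_const (MDiffAlongAt.zero hi) v

theorem covAlong_sum {ι : Type*} (s : Finset ι) {V : ι → VFieldAlong E' i}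
    (hi : MDifferentiableAt 𝓘(ℝ, E) 𝓘(ℝ, E') i x) (hV : ∀ k ∈ s, MDiffAlongAt E E' i (V k) x)
    (v : TangentSpace 𝓘(ℝ, E) x) :
    covAlong cov i (fun y ↦ ∑ k ∈ s, V k y) x v = ∑ k ∈ s, covAlong cov i (V k) x v := by
  classical
  induction s using Finset.induction_on with
  | empty => simpa using covAlong_zero cov v hi
  | insert k s hk ih =>
    simp only [Finset.sum_insert hk]
    have hs : ∀ l ∈ s, MDiffAlongAt E E' i (V l) x := fun l hl ↦ hV l (by simp [hl])
    rw [covAlong_add cov (hV k (by simp)) (MDiffAlongAt.sum s hi hs), ih hs]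

/-! ### Parallel tensor fields along a map -/

section Parallel

variable {J : EndField E' M'}

theorem MDiffAlongAt.endField (hJ : SmoothEndField J) (hV : MDiffAlongAt E E' i V x) :
    MDiffAlongAt E E' i (fun y ↦ J (i y) (V y)) x := by
  have hi := (mdiffAlongAt_iff.1 hV).1
  exact MDifferentiableAt.clm_bundle_apply (F₁ := E') (F₂ := E')
    (E₁ := (TangentSpace 𝓘(ℝ, E') : M' → Type _)) (E₂ := (TangentSpace 𝓘(ℝ, E') : M' → Type _))
    (ϕ := fun y ↦ J (i y))
    (MDifferentiableAt.comp x ((hJ (i x)).mdifferentiableAt (by simp)) hi) hV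

variable [FiniteDimensional ℝ E'] [FiniteDimensional ℝ E] [IsManifold 𝓘(ℝ, E) ∞ M]
  [RiemannianBundle (fun x : M ↦ TangentSpace 𝓘(ℝ, E) x)]
  [RiemannianBundle (fun y : M' ↦ TangentSpace 𝓘(ℝ, E') y)]

/-- A parallel `(1,1)`-tensor field commutes with the covariant derivative along a map. -/
theorem covAlong_endField (hJ : SmoothEndField J) (hpar : ∀ (Y : VField E' M') (x : M'),
    MDifferentiableAt 𝓘(ℝ, E') 𝓘(ℝ, E').tangent
      (fun y ↦ (⟨y, Y y⟩ : TangentBundle 𝓘(ℝ, E') M')) x →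
    ∀ v : TangentSpace 𝓘(ℝ, E') x, cov (fun y ↦ J y (Y y)) x v = J x (cov Y x v))
    (hV : MDiffAlongAt E E' i V x) (v : TangentSpace 𝓘(ℝ, E) x) :
    covAlong cov i (fun y ↦ J (i y) (V y)) x v = J (i x) (covAlong cov i V x v) := by
  have hi := (mdiffAlongAt_iff.1 hV).1
  -- Both sides obey the same Leibniz rule in V, so only restrictions W ∘ i matter, and there the
  -- claim is ∇'J = 0 on the ambient manifold.
  refine hV.induction (Q := fun V ↦ covAlong cov i (fun y ↦ J (i y) (V y)) x v
    = J (i x) (covAlong cov i V x v)) ?_ ?_ ?_ ?_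
  · intro W hW
    have hJW : MDifferentiableAt 𝓘(ℝ, E') 𝓘(ℝ, E').tangent
        (fun y ↦ (⟨y, J y (W y)⟩ : TangentBundle 𝓘(ℝ, E') M')) (i x) :=
      MDiffAlongAt.endField (i := id) hJ hW
    rw [covAlong_comp cov hi W hW, ← hpar W _ hW]
    exact covAlong_comp cov hi (fun y ↦ J y (W y)) hJW v
  · intro V W hV hW h1 h2
    simp only [map_add]
    rw [covAlong_add cov (hV.endField hJ) (hW.endField hJ), covAlong_add cov hV hW, h1, h2, map_add]
  · intro f V hf hV h
    simp only [map_smul]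
    rw [covAlong_smul cov hf (hV.endField hJ), covAlong_smul cov hf hV, h, map_add, map_smul,
      map_smul]
  · intro V W hVW hV h
    rw [covAlong_congr cov (V := fun y ↦ J (i y) (W y)) (W := fun y ↦ J (i y) (V y)), h,
      covAlong_congr cov hVW]
    filter_upwards [hVW] with y hy
    rw [hy]

end Parallel

/-! ### Metric compatibility along a map -/

section Metric

variable [RiemannianBundle (fun y : M' ↦ TangentSpace 𝓘(ℝ, E') y)]
  [IsContMDiffRiemannianBundle 𝓘(ℝ, E') ∞ E' (fun y : M' ↦ TangentSpace 𝓘(ℝ, E') y)]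

theorem MDiffAlongAt.inner (hV : MDiffAlongAt E E' i V x) (hW : MDiffAlongAt E E' i W x) :
    MDifferentiableAt 𝓘(ℝ, E) 𝓘(ℝ, ℝ) (fun y ↦ inner ℝ (V y) (W y)) x := by
  have : IsContMDiffRiemannianBundle 𝓘(ℝ, E') 1 E' (fun y : M' ↦ TangentSpace 𝓘(ℝ, E') y) :=
    .of_le (n := ∞) (by exact_mod_cast le_top)
  exact MDifferentiableAt.inner_bundle hV hW

variable [FiniteDimensional ℝ E'] [FiniteDimensional ℝ E] [IsManifold 𝓘(ℝ, E) ∞ M]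
  [RiemannianBundle (fun x : M ↦ TangentSpace 𝓘(ℝ, E) x)]

/-- The covariant derivative along a map is compatible with the metric. -/
theorem mvfderiv_inner_along (hcov : IsLeviCivita cov) (hV : MDiffAlongAt E E' i V x)
    (hW : MDiffAlongAt E E' i W x) (v : TangentSpace 𝓘(ℝ, E) x) :
    mvfderiv 𝓘(ℝ, E) (fun y ↦ inner ℝ (V y) (W y)) x v =
      inner ℝ (covAlong cov i V x v) (W x) + inner ℝ (V x) (covAlong cov i W x v) := by
  have hi := (mdiffAlongAt_iff.1 hV).1
  have hadd : ∀ V V' W : VFieldAlong E' i, MDiffAlongAt E E' i V x → MDiffAlongAt E E' i V' x →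
      MDiffAlongAt E E' i W x →
      mvfderiv 𝓘(ℝ, E) (fun y ↦ inner ℝ (V y + V' y) (W y)) x v =
        mvfderiv 𝓘(ℝ, E) (fun y ↦ inner ℝ (V y) (W y)) x v
          + mvfderiv 𝓘(ℝ, E) (fun y ↦ inner ℝ (V' y) (W y)) x v := by
    intro V V' W hV hV' hW
    simp only [inner_add_left]
    exact congrArg (fun L : TangentSpace 𝓘(ℝ, E) x →L[ℝ] ℝ ↦ L v)
      (mvfderiv_add (hV.inner hW) (hV'.inner hW))
  have hsmul : ∀ (f : M → ℝ) (V W : VFieldAlong E' i), MDifferentiableAt 𝓘(ℝ, E) 𝓘(ℝ, ℝ) f x →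
      MDiffAlongAt E E' i V x → MDiffAlongAt E E' i W x →
      mvfderiv 𝓘(ℝ, E) (fun y ↦ inner ℝ (f y • V y) (W y)) x v =
        f x * mvfderiv 𝓘(ℝ, E) (fun y ↦ inner ℝ (V y) (W y)) x v
          + mvfderiv 𝓘(ℝ, E) f x v * inner ℝ (V x) (W x) := by
    intro f V W hf hV hW
    simp only [real_inner_smul_left]
    exact congrArg (fun L : TangentSpace 𝓘(ℝ, E) x →L[ℝ] ℝ ↦ L v)
      (mvfderiv_smul hf (hV.inner hW))
  have hcongr : ∀ V V' W : VFieldAlong E' i, (∀ᶠ y in nhds x, V y = V' y) →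
      mvfderiv 𝓘(ℝ, E) (fun y ↦ (inner ℝ (V y) (W y) : ℝ)) x =
        mvfderiv 𝓘(ℝ, E) (fun y ↦ (inner ℝ (V' y) (W y) : ℝ)) x := by
    intro V V' W h
    refine mvfderiv_congr_of_eventuallyEq ?_
    filter_upwards [h] with y hy
    rw [hy]
  refine hV.induction (Q := fun V ↦ mvfderiv 𝓘(ℝ, E) (fun y ↦ inner ℝ (V y) (W y)) x v =
      inner ℝ (covAlong cov i V x v) (W x) + inner ℝ (V x) (covAlong cov i W x v)) ?_ ?_ ?_ ?_
  · intro A hA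
    have hAi : MDiffAlongAt E E' i (fun y ↦ A (i y)) x := .comp hi hA
    -- Swapping the factors puts W in the first slot, so that `hadd`, `hsmul` and `hcongr` also
    -- serve the induction on W.
    simp only [real_inner_comm (W _), real_inner_comm (covAlong cov i W x v)]
    refine hW.induction (Q := fun W ↦ mvfderiv 𝓘(ℝ, E) (fun y ↦ inner ℝ (W y) (A (i y))) x v =
      inner ℝ (W x) (covAlong cov i (fun y ↦ A (i y)) x v)
        + inner ℝ (covAlong cov i W x v) (A (i x))) ?_ ?_ ?_ ?_
    · intro B hB
      -- With both fields restricted from the ambient manifold, the claim is the chain rule and the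
      -- metric property there.
      have hd : MDifferentiableAt 𝓘(ℝ, E') 𝓘(ℝ, ℝ) (fun z ↦ inner ℝ (B z) (A z)) (i x) :=
        MDiffAlongAt.inner (i := id) hB hA
      have hc := congrArg (fun L : TangentSpace 𝓘(ℝ, E) x →L[ℝ] ℝ ↦ L v) (mfderiv_comp x hd hi)
      rw [covAlong_comp cov hi A hA, covAlong_comp cov hi B hB, add_comm,
        ← hcov.metric B A (i x) hB hA]
      exact hc
    · intro V W hV hW h1 h2
      rw [hadd V W _ hV hW hAi, covAlong_add cov hV hW, h1, h2]
      simp only [inner_add_left]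
      ring
    · intro f V hf hV h
      rw [hsmul f V _ hf hV hAi, covAlong_smul cov hf hV, h]
      simp only [inner_add_left, real_inner_smul_left]
      ring
    · intro V W hVW hV h
      rw [← hcongr V W _ hVW, ← covAlong_congr cov hVW, h, hVW.self_of_nhds]
  · intro V V' hV hV' h1 h2
    rw [hadd V V' _ hV hV' hW, covAlong_add cov hV hV', h1, h2]
    simp only [inner_add_left]
    ring
  · intro f V hf hV h
    rw [hsmul f V _ hf hV hW, covAlong_smul cov hf hV, h]
    simp only [inner_add_left, real_inner_smul_left]
    ring
  · intro V V' hVV hV h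
    rw [← hcongr V V' _ hVV, ← covAlong_congr cov hVV, h, hVV.self_of_nhds]

end Metric

/-! ### Torsion of the pullback connection -/

section Torsion

/-- The tangent bundle is trivialized by differentials of charts. This turns the components of i_*V
into derivatives of a chart composed with `i`. -/
theorem trivializationAt_snd_eq {z y : M'} (hz : z ∈ (chartAt E' y).source)
    (w : TangentSpace 𝓘(ℝ, E') z) :
    (trivializationAt E' (TangentSpace 𝓘(ℝ, E')) y (⟨z, w⟩ : TangentBundle 𝓘(ℝ, E') M')).2
      = mvfderiv 𝓘(ℝ, E') (extChartAt 𝓘(ℝ, E') y) z w := by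
  rw [← Trivialization.continuousLinearMapAt_apply_of_mem (R := ℝ) _ hz]
  exact congrArg (fun L : E' →L[ℝ] E' ↦ L w)
    (TangentBundle.continuousLinearMapAt_trivializationAt (I := 𝓘(ℝ, E')) hz)

/-- The tangent space at y is modelled on `E'` through the preferred chart at y itself. -/
theorem mvfderiv_extChartAt_self (y : M') (w : TangentSpace 𝓘(ℝ, E') y) :
    mvfderiv 𝓘(ℝ, E') (extChartAt 𝓘(ℝ, E') y) y w = w :=
  congrArg (fun L : E' →L[ℝ] E' ↦ L w) mfderiv_extChartAt_self

theorem symmL_trivializationAt_self (y : M') (w : E') :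
    (trivializationAt E' (TangentSpace 𝓘(ℝ, E')) y).symmL ℝ y w = w := by
  have hy := FiberBundle.mem_baseSet_trivializationAt' (F := E')
    (E := (TangentSpace 𝓘(ℝ, E') : M' → Type _)) y
  have h := trivializationAt_snd_eq (mem_chart_source E' y)
    ((trivializationAt E' (TangentSpace 𝓘(ℝ, E')) y).symmL ℝ y w)
  rw [mvfderiv_extChartAt_self] at h
  rw [← h, Trivialization.symmL_apply _ hy, Trivialization.apply_mk_symm _ hy]

theorem eventually_mvfderiv_extChartAt_comp (hi : ContMDiff 𝓘(ℝ, E) 𝓘(ℝ, E') ∞ i) :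
    ∀ᶠ y in nhds x, ∀ v : TangentSpace 𝓘(ℝ, E) y,
      mvfderiv 𝓘(ℝ, E) (extChartAt 𝓘(ℝ, E') (i x) ∘ i) y v =
        mvfderiv 𝓘(ℝ, E') (extChartAt 𝓘(ℝ, E') (i x)) (i y) (push i y v) := by
  have hid : ∀ y, MDifferentiableAt 𝓘(ℝ, E) 𝓘(ℝ, E') i y := fun y ↦
    (hi y).mdifferentiableAt (by simp)
  filter_upwards [eventually_mem_baseSet (E' := E') (hid x).continuousAt] with y hy v
  exact congrArg (fun L : E →L[ℝ] E' ↦ L v)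
    (mfderiv_comp y (mdifferentiableAt_extChartAt (I := 𝓘(ℝ, E')) hy) (hid y))

variable [FiniteDimensional ℝ E']

/-- Fields with constant components in one chart commute: by d(dφ) = 0 for the chart φ, the
components of the bracket are differences of derivatives of constants. -/
theorem mlieBracket_extend (y : M') (v w : TangentSpace 𝓘(ℝ, E') y) :
    VectorField.mlieBracket 𝓘(ℝ, E') (FiberBundle.extend E' v) (FiberBundle.extend E' w) y = 0 := by
  have hconst : ∀ v w : TangentSpace 𝓘(ℝ, E') y, mvfderiv 𝓘(ℝ, E')
      (fun z ↦ mvfderiv 𝓘(ℝ, E') (extChartAt 𝓘(ℝ, E') y) z (FiberBundle.extend E' v z)) y w = 0 := by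
    intro v w
    have h : (fun z ↦ mvfderiv 𝓘(ℝ, E') (extChartAt 𝓘(ℝ, E') y) z (FiberBundle.extend E' v z))
        =ᶠ[nhds y] fun _ ↦
          (trivializationAt E' (TangentSpace 𝓘(ℝ, E') : M' → Type _) y ⟨y, v⟩).2 := by
      filter_upwards [(chartAt E' y).open_source.mem_nhds (mem_chart_source E' y)] with z hz
      rw [← trivializationAt_snd_eq hz, FiberBundle.extend, Trivialization.apply_mk_symm _ hz]
    rw [mvfderiv_congr_of_eventuallyEq h, mvfderiv_const]
    rfl
  have h := mvfderiv_mlieBracket (contMDiffAt_extChartAt (I := 𝓘(ℝ, E')) (x := y) (n := 2))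
    (FiberBundle.mdifferentiableAt_extend 𝓘(ℝ, E') E' v)
    (FiberBundle.mdifferentiableAt_extend 𝓘(ℝ, E') E' w)
  rw [hconst, hconst, sub_zero, mvfderiv_extChartAt_self] at h
  exact h

variable [CompleteSpace E] [IsManifold 𝓘(ℝ, E) ∞ M]

/-- The pullback of a torsion-free connection: `∇'_X (i_* Y) - ∇'_Y (i_* X) = i_* [X, Y]`. -/
theorem covAlong_push_sub (hcov : cov.torsion = 0) (hi : ContMDiff 𝓘(ℝ, E) 𝓘(ℝ, E') ∞ i)
    {X Y : VField E M}
    (hX : MDifferentiableAt 𝓘(ℝ, E) 𝓘(ℝ, E).tangent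
      (fun y ↦ (⟨y, X y⟩ : TangentBundle 𝓘(ℝ, E) M)) x)
    (hY : MDifferentiableAt 𝓘(ℝ, E) 𝓘(ℝ, E).tangent
      (fun y ↦ (⟨y, Y y⟩ : TangentBundle 𝓘(ℝ, E) M)) x) :
    covAlong cov i (fun y ↦ push i y (Y y)) x (X x)
      - covAlong cov i (fun y ↦ push i y (X y)) x (Y x)
      = push i x (VectorField.mlieBracket 𝓘(ℝ, E) X Y x) := by
  have hid : ∀ y, MDifferentiableAt 𝓘(ℝ, E) 𝓘(ℝ, E') i y := fun y ↦
    (hi y).mdifferentiableAt (by simp)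
  set h : M → E' := extChartAt 𝓘(ℝ, E') (i x) ∘ i with hh
  have hh2 : ContMDiffAt 𝓘(ℝ, E) 𝓘(ℝ, E') 2 h x :=
    ContMDiffAt.comp x (contMDiffAt_extChartAt (I := 𝓘(ℝ, E')) (x := i x) (n := 2))
      ((hi x).of_le (by exact_mod_cast ENat.LEInfty.out))
  have hdh := eventually_mvfderiv_extChartAt_comp (x := x) hi
  -- The components of i_*V are dh(V), so the derivative terms of the two sides of the difference
  -- combine to dh([X,Y]).
  have hcoord : ∀ V : VField E M, alongCoord E' i (fun y ↦ push i y (V y)) x =ᶠ[nhds x]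
      fun y ↦ mvfderiv 𝓘(ℝ, E) h y (V y) := by
    intro V
    filter_upwards [hdh, eventually_mem_baseSet (E' := E') (hid x).continuousAt] with y hdh hy
    rw [hdh, alongCoord, trivializationAt_snd_eq hy]
  -- The connection terms cancel: the torsion vanishes and the two extended fields commute.
  have htor := (cov.torsion_eq_zero_iff.1 hcov)
    (FiberBundle.mdifferentiableAt_extend 𝓘(ℝ, E') E' (push i x (X x)))
    (FiberBundle.mdifferentiableAt_extend 𝓘(ℝ, E') E' (push i x (Y x)))
  rw [mlieBracket_extend, FiberBundle.extend_apply_self, FiberBundle.extend_apply_self] at htor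
  have hbr := mvfderiv_mlieBracket hh2 hX hY
  rw [hdh.self_of_nhds, mvfderiv_extChartAt_self] at hbr
  rw [covAlong_apply, covAlong_apply, mvfderiv_congr_of_eventuallyEq (hcoord X),
    mvfderiv_congr_of_eventuallyEq (hcoord Y), hbr, add_sub_add_comm, htor, add_zero, ← map_sub]
  exact symmL_trivializationAt_self (i x) _

end Torsion

end CovAlong

/-! ### Differentiability of a field and of its push-forward -/

section Push

variable {E : Type*} [NormedAddCommGroup E] [NormedSpace ℝ E] [FiniteDimensional ℝ E]
  {M : Type*} [TopologicalSpace M] [ChartedSpace E M] [IsManifold 𝓘(ℝ, E) ∞ M]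
  {E' : Type*} [NormedAddCommGroup E'] [NormedSpace ℝ E']
  {M' : Type*} [TopologicalSpace M'] [ChartedSpace E' M'] [IsManifold 𝓘(ℝ, E') ∞ M']
  {i : M → M'} {x : M}

omit [FiniteDimensional ℝ E] in
theorem MDiffAlongAt.push (hi : ContMDiff 𝓘(ℝ, E) 𝓘(ℝ, E') ∞ i) {Z : VField E M}
    (hZ : MDifferentiableAt 𝓘(ℝ, E) 𝓘(ℝ, E).tangent
      (fun y ↦ (⟨y, Z y⟩ : TangentBundle 𝓘(ℝ, E) M)) x) :
    MDiffAlongAt E E' i (fun y ↦ push i y (Z y)) x :=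
  MDifferentiableAt.comp (g := tangentMap 𝓘(ℝ, E) 𝓘(ℝ, E') i) x
    ((hi.contMDiff_tangentMap (m := 1) (by exact_mod_cast ENat.LEInfty.out)).mdifferentiableAt
      one_ne_zero) hZ

omit [IsManifold 𝓘(ℝ, E) ∞ M] in
/-- A function is differentiable if its image under a differentiable family of linear maps is, and
the linear map at the base point is injective. -/
theorem mdifferentiableAt_of_clm_apply {F : Type*} [NormedAddCommGroup F] [NormedSpace ℝ F]
    [FiniteDimensional ℝ F] {A : M → E →L[ℝ] F} {ζ : M → E}
    (hA : MDifferentiableAt 𝓘(ℝ, E) 𝓘(ℝ, E →L[ℝ] F) A x) (hinj : Function.Injective (A x))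
    (hw : MDifferentiableAt 𝓘(ℝ, E) 𝓘(ℝ, F) (fun y ↦ A y (ζ y)) x) :
    MDifferentiableAt 𝓘(ℝ, E) 𝓘(ℝ, E) ζ x := by
  have : CompleteSpace E := FiniteDimensional.complete ℝ E
  -- With L a left inverse of A(x), the endomorphism L A(y) stays invertible near x, and ζ = (L A)⁻¹
  -- L(A ζ) there.
  obtain ⟨L₀, hL₀⟩ := LinearMap.exists_leftInverse_of_injective (A x).toLinearMap
    (LinearMap.ker_eq_bot.2 hinj)
  let L : F →L[ℝ] E := LinearMap.toContinuousLinearMap L₀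
  let B : M → E →L[ℝ] E := fun y ↦ L.comp (A y)
  have hBx : B x = 1 := by
    ext v
    exact congrArg (fun K : E →ₗ[ℝ] E ↦ K v) hL₀
  have hB : MDifferentiableAt 𝓘(ℝ, E) 𝓘(ℝ, E →L[ℝ] E) B x :=
    (ContinuousLinearMap.compL ℝ E F E L).mdifferentiableAt.comp x hA
  have hunit : ∀ᶠ y in nhds x, IsUnit (B y) :=
    hB.continuousAt.eventually (Units.isOpen.mem_nhds (by rw [hBx]; exact isUnit_one))
  have hinv : MDifferentiableAt 𝓘(ℝ, E) 𝓘(ℝ, E →L[ℝ] E) (fun y ↦ Ring.inverse (B y)) x :=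
    MDifferentiableAt.comp x (I' := 𝓘(ℝ, E →L[ℝ] E)) (g := Ring.inverse)
      (differentiableAt_inverse (𝕜 := ℝ) (by rw [hBx]; exact isUnit_one)).mdifferentiableAt hB
  have hLw : MDifferentiableAt 𝓘(ℝ, E) 𝓘(ℝ, E) (fun y ↦ L (A y (ζ y))) x :=
    L.mdifferentiableAt.comp x hw
  refine (hinv.clm_apply hLw).congr_of_eventuallyEq ?_
  filter_upwards [hunit] with y hy
  exact (congrArg (fun K : E →L[ℝ] E ↦ K (ζ y)) (Ring.inverse_mul_cancel _ hy)).symm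

variable [FiniteDimensional ℝ E']

/-- In charts, the components of i_*Z are the derivative of the local expression of `i` applied to
those of Z. That derivative varies differentiably and is injective at x, so Z can be solved for. -/
theorem mdifferentiableAt_of_push (hi : ContMDiff 𝓘(ℝ, E) 𝓘(ℝ, E') ∞ i)
    (hinj : Function.Injective (push (E := E) (E' := E') i x)) {Z : VField E M}
    (hZ : MDiffAlongAt E E' i (fun y ↦ push i y (Z y)) x) :
    MDifferentiableAt 𝓘(ℝ, E) 𝓘(ℝ, E).tangent
      (fun y ↦ (⟨y, Z y⟩ : TangentBundle 𝓘(ℝ, E) M)) x := by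
  have hid : ∀ y, MDifferentiableAt 𝓘(ℝ, E) 𝓘(ℝ, E') i y := fun y ↦
    (hi y).mdifferentiableAt (by simp)
  set h : M → E' := extChartAt 𝓘(ℝ, E') (i x) ∘ i with hh
  set φ := extChartAt 𝓘(ℝ, E) x with hφ
  have hh2 : ContMDiffAt 𝓘(ℝ, E) 𝓘(ℝ, E') 2 h x :=
    ContMDiffAt.comp x (contMDiffAt_extChartAt (I := 𝓘(ℝ, E')) (x := i x) (n := 2))
      ((hi x).of_le (by exact_mod_cast ENat.LEInfty.out))
  obtain ⟨hH, hdh⟩ := eventually_mvfderiv_eq_fderiv_extChartAt hh2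
  have hpush := eventually_mvfderiv_extChartAt_comp (x := x) hi
  rw [mdifferentiableAt_section]
  have hφx : MDifferentiableAt 𝓘(ℝ, E) 𝓘(ℝ, E) φ x :=
    mdifferentiableAt_extChartAt (mem_chart_source E x)
  have hA : MDifferentiableAt 𝓘(ℝ, E) 𝓘(ℝ, E →L[ℝ] E')
      (fun y ↦ fderiv ℝ (h ∘ φ.symm) (φ y)) x :=
    MDifferentiableAt.comp x (I' := 𝓘(ℝ, E)) (g := fderiv ℝ (h ∘ φ.symm))
      ((hH.fderiv_right (m := 1) (by norm_num)).differentiableAt one_ne_zero).mdifferentiableAt hφx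
  refine mdifferentiableAt_of_clm_apply hA ?_ ?_
  · intro v w hvw
    refine hinj ?_
    have h1 : ∀ v : TangentSpace 𝓘(ℝ, E) x,
        fderiv ℝ (h ∘ φ.symm) (φ x) v = push (E := E) (E' := E') i x v := by
      intro v
      have := hdh.self_of_nhds v
      rw [mvfderiv_extChartAt_self, hpush.self_of_nhds, mvfderiv_extChartAt_self] at this
      exact this.symm
    exact (h1 v).symm.trans (hvw.trans (h1 w))
  · refine (mdiffAlongAt_iff.1 hZ).2.congr_of_eventuallyEq ?_
    have hsrc : ∀ᶠ y in nhds x, y ∈ (chartAt E x).source :=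
      (chartAt E x).open_source.mem_nhds (mem_chart_source E x)
    filter_upwards [hdh, hpush, eventually_mem_baseSet (E' := E') (hid x).continuousAt, hsrc]
      with y h1 h2 h3 h4
    rw [trivializationAt_snd_eq h4, ← h1, h2, alongCoord, trivializationAt_snd_eq h3]

end Push

/-! ### Geometry of the submanifold and its induced structure -/

section StructureEquations

variable {E : Type*} [NormedAddCommGroup E] [NormedSpace ℝ E] [FiniteDimensional ℝ E]
  {M : Type*} [TopologicalSpace M] [ChartedSpace E M] [IsManifold 𝓘(ℝ, E) ∞ M]
  [RiemannianBundle (fun x : M ↦ TangentSpace 𝓘(ℝ, E) x)]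
  {E' : Type*} [NormedAddCommGroup E'] [NormedSpace ℝ E'] [FiniteDimensional ℝ E']
  {M' : Type*} [TopologicalSpace M'] [ChartedSpace E' M'] [IsManifold 𝓘(ℝ, E') ∞ M']
  [RiemannianBundle (fun y : M' ↦ TangentSpace 𝓘(ℝ, E') y)]
  {r : ℕ} {J : EndField E' M'}
  {cov : CovariantDerivative 𝓘(ℝ, E') E' (fun y : M' ↦ TangentSpace 𝓘(ℝ, E') y)}
  {i : M → M'} {U : Set M} {ν : Fin r → VFieldAlong E' i} {x : M}

/-! ### Pointwise identities -/

omit [FiniteDimensional ℝ E] [IsManifold 𝓘(ℝ, E) ∞ M] [FiniteDimensional ℝ E']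
  [IsManifold 𝓘(ℝ, E') ∞ M'] in
theorem IsIsometricImmersion.push_injective (hi : IsIsometricImmersion E E' i) (x : M) :
    Function.Injective (push (E := E) (E' := E') i x) := by
  refine (injective_iff_map_eq_zero _).2 fun v hv ↦ ?_
  have h := hi.isometric x v v
  rw [hv, inner_zero_left] at h
  exact inner_self_eq_zero.1 h.symm

theorem tangentPart_push (hi : IsIsometricImmersion E E' i) (v : TangentSpace 𝓘(ℝ, E) x) :
    tangentPart i x (push (E' := E') i x v) = v :=
  ext_inner_right ℝ fun w ↦ by rw [inner_tangentPart, hi.isometric]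

theorem tangentPart_normal (hν : IsNormalFrame E i U ν) (hx : x ∈ U) (α : Fin r) :
    tangentPart (E := E) i x (ν α x) = 0 :=
  ext_inner_right ℝ fun w ↦ by rw [inner_tangentPart, hν.normal α x hx, inner_zero_left]

theorem inner_inducedP_left (hJ : ∀ (x : M') (v w : TangentSpace 𝓘(ℝ, E') x),
      (inner ℝ (J x v) w : ℝ) = inner ℝ v (J x w)) (v w : TangentSpace 𝓘(ℝ, E) x) :
    (inner ℝ (inducedP J i x v) w : ℝ) = inner ℝ v (inducedP J i x w) := by
  simp only [inducedP, ContinuousLinearMap.comp_apply]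
  rw [inner_tangentPart, hJ, ← real_inner_comm v, inner_tangentPart, real_inner_comm]

/-- Self-adjointness of J moves it from i_*v onto N_α, making u_α the form dual to ξ_α. -/
theorem inducedU_apply (hJ : ∀ (x : M') (v w : TangentSpace 𝓘(ℝ, E') x),
      (inner ℝ (J x v) w : ℝ) = inner ℝ v (J x w)) (α : Fin r) (v : TangentSpace 𝓘(ℝ, E) x) :
    inducedU J i ν α x v = inner ℝ v (inducedXi J i ν α x) := by
  rw [real_inner_comm, inducedXi, inner_tangentPart, hJ]
  rfl

omit [IsManifold 𝓘(ℝ, E) ∞ M] in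
theorem tangentPart_covAlong_normal (α : Fin r) (v : TangentSpace 𝓘(ℝ, E) x) :
    tangentPart i x (covAlong cov i (ν α) x v) = -shape cov i ν α x v := by
  simp [shape]

theorem normalCoeff_apply (hν : IsNormalFrame E i U ν) (hx : x ∈ U) (α β : Fin r)
    (v : TangentSpace 𝓘(ℝ, E) x) :
    normalCoeff cov i ν α β x v = inner ℝ (ν β x) (covAlong cov i (ν α) x v) := by
  simp only [normalCoeff, normalCov, normalPart, ContinuousLinearMap.comp_apply,
      innerSL_apply_apply, sub_apply, inner_sub_right,
      ContinuousLinearMap.id_apply, hν.normal _ x hx, sub_zero]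

omit [FiniteDimensional ℝ E] [IsManifold 𝓘(ℝ, E) ∞ M]
  [RiemannianBundle (fun x : M ↦ TangentSpace 𝓘(ℝ, E) x)] [FiniteDimensional ℝ E'] in
theorem IsNormalFrame.mdiffAlongAt (hν : IsNormalFrame E i U ν) (hx : x ∈ U) (α : Fin r) :
    MDiffAlongAt E E' i (ν α) x :=
  ((hν.smooth α).contMDiffAt (hν.isOpen.mem_nhds hx)).mdifferentiableAt (by simp)

/-! ### The Gauss and Weingarten formulas -/

variable [IsContMDiffRiemannianBundle 𝓘(ℝ, E') ∞ E' (fun y : M' ↦ TangentSpace 𝓘(ℝ, E') y)]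

/-- Differentiate g(N_α, N_β), which is constant on U. -/
theorem normalCoeff_antisymm (hcov : IsLeviCivita cov) (hν : IsNormalFrame E i U ν) (hx : x ∈ U)
    (α β : Fin r) (v : TangentSpace 𝓘(ℝ, E) x) :
    normalCoeff cov i ν α β x v = -normalCoeff cov i ν β α x v := by
  have h := mvfderiv_inner_along cov hcov (hν.mdiffAlongAt hx α) (hν.mdiffAlongAt hx β) v
  have hc : (fun y ↦ (inner ℝ (ν α y) (ν β y) : ℝ)) =ᶠ[nhds x]
      fun _ ↦ if α = β then (1 : ℝ) else 0 := by
    filter_upwards [hν.isOpen.mem_nhds hx] with y hy using hν.orthonormal α β y hy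
  rw [mvfderiv_congr_of_eventuallyEq hc, mvfderiv_const, real_inner_comm] at h
  rw [normalCoeff_apply hν hx, normalCoeff_apply hν hx]
  exact eq_neg_of_add_eq_zero_left h.symm

/-- The normal components of `∇'_v (i_* V)`, given by the shape operators. -/
theorem inner_normal_covAlong_push (hcov : IsLeviCivita cov) (hi : IsIsometricImmersion E E' i)
    (hν : IsNormalFrame E i U ν) (hx : x ∈ U) {V : VField E M}
    (hV : MDifferentiableAt 𝓘(ℝ, E) 𝓘(ℝ, E).tangent
      (fun y ↦ (⟨y, V y⟩ : TangentBundle 𝓘(ℝ, E) M)) x)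
    (α : Fin r) (v : TangentSpace 𝓘(ℝ, E) x) :
    (inner ℝ (ν α x) (covAlong cov i (fun y ↦ push i y (V y)) x v) : ℝ)
      = inner ℝ (shape cov i ν α x v) (V x) := by
  have h := mvfderiv_inner_along cov hcov (hν.mdiffAlongAt hx α) (.push hi.smooth hV) v
  -- Orthogonality holds on a neighbourhood of x, so it can be differentiated.
  have hc : (fun y ↦ (inner ℝ (ν α y) (push i y (V y)) : ℝ)) =ᶠ[nhds x] fun _ ↦ (0 : ℝ) := by
    filter_upwards [hν.isOpen.mem_nhds hx] with y hy using hν.normal α y hy _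
  rw [mvfderiv_congr_of_eventuallyEq hc, mvfderiv_const, ← inner_tangentPart,
    tangentPart_covAlong_normal, inner_neg_left] at h
  have h' : (0 : ℝ) = -inner ℝ (shape cov i ν α x v) (V x)
    + inner ℝ (ν α x) (covAlong cov i (fun y ↦ push i y (V y)) x v) := h
  linarith

/-- For extensions V, W of v, w, the difference ∇'_v(i_*W) − ∇'_w(i_*V) = i_*[V,W] has no normal
component. -/
theorem inner_shape_comm (hcov : IsLeviCivita cov) (hi : IsIsometricImmersion E E' i)
    (hν : IsNormalFrame E i U ν) (hx : x ∈ U) (α : Fin r) (v w : TangentSpace 𝓘(ℝ, E) x) :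
    (inner ℝ (shape cov i ν α x v) w : ℝ) = inner ℝ v (shape cov i ν α x w) := by
  have : CompleteSpace E := FiniteDimensional.complete ℝ E
  have hd := fun v : TangentSpace 𝓘(ℝ, E) x ↦ FiberBundle.mdifferentiableAt_extend 𝓘(ℝ, E) E v
  have h := covAlong_push_sub cov hcov.torsion_eq_zero hi.smooth (hd v) (hd w)
  have h' := congrArg (fun z ↦ (inner ℝ (ν α x) z : ℝ)) h
  simp only [inner_sub_right, hν.normal α x hx, inner_normal_covAlong_push hcov hi hν hx (hd _),
    FiberBundle.extend_apply_self] at h'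
  rw [← real_inner_comm v]
  linarith

/-- The tangential component of `∇'_v (i_* V)`: the Levi-Civita connection of `M`. -/
def inducedCov (cov : CovariantDerivative 𝓘(ℝ, E') E' (fun y : M' ↦ TangentSpace 𝓘(ℝ, E') y))
    (i : M → M') (V : VField E M) (x : M) (v : TangentSpace 𝓘(ℝ, E) x) : TangentSpace 𝓘(ℝ, E) x :=
  tangentPart i x (covAlong cov i (fun y ↦ push i y (V y)) x v)

omit [IsContMDiffRiemannianBundle 𝓘(ℝ, E') ∞ E' (fun y : M' ↦ TangentSpace 𝓘(ℝ, E') y)] in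
-- Tangential part of the torsion identity along `i`. It converts every bracket in N_P and du_α into
-- covariant derivatives.
theorem inducedCov_sub (hcov : cov.torsion = 0) (hi : IsIsometricImmersion E E' i)
    {X Y : VField E M}
    (hX : MDifferentiableAt 𝓘(ℝ, E) 𝓘(ℝ, E).tangent
      (fun y ↦ (⟨y, X y⟩ : TangentBundle 𝓘(ℝ, E) M)) x)
    (hY : MDifferentiableAt 𝓘(ℝ, E) 𝓘(ℝ, E).tangent
      (fun y ↦ (⟨y, Y y⟩ : TangentBundle 𝓘(ℝ, E) M)) x) :
    VectorField.mlieBracket 𝓘(ℝ, E) X Y x =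
      inducedCov cov i Y x (X x) - inducedCov cov i X x (Y x) := by
  have : CompleteSpace E := FiniteDimensional.complete ℝ E
  rw [inducedCov, inducedCov, ← map_sub, covAlong_push_sub cov hcov hi.smooth hX hY,
    tangentPart_push hi]

/-- The Gauss formula, with the second fundamental form expressed through the shape operators. -/
theorem covAlong_push (hdim : finrank ℝ E' = finrank ℝ E + r)
    (hcov : IsLeviCivita cov) (hi : IsIsometricImmersion E E' i)
    (hν : IsNormalFrame E i U ν) (hx : x ∈ U) {V : VField E M}
    (hV : MDifferentiableAt 𝓘(ℝ, E) 𝓘(ℝ, E).tangent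
      (fun y ↦ (⟨y, V y⟩ : TangentBundle 𝓘(ℝ, E) M)) x) (v : TangentSpace 𝓘(ℝ, E) x) :
    covAlong cov i (fun y ↦ push i y (V y)) x v = push i x (inducedCov cov i V x v)
      + ∑ α, (inner ℝ (shape cov i ν α x v) (V x) : ℝ) • ν α x := by
  refine (eq_push_tangentPart_add_sum (E := E) hdim hi hν hx _).trans ?_
  congr 1
  refine Finset.sum_congr rfl fun α _ ↦ ?_
  rw [real_inner_comm, inner_normal_covAlong_push hcov hi hν hx hV]

/-! ### The structure equations of the induced structure -/

variable {p q : ℕ}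

omit [FiniteDimensional ℝ E] [FiniteDimensional ℝ E'] in
theorem mdifferentiableAt_inducedU (hJ : IsMetallicRiemannian p q J)
    (hi : IsIsometricImmersion E E' i)
    (hν : IsNormalFrame E i U ν) (hx : x ∈ U) {V : VField E M}
    (hV : MDifferentiableAt 𝓘(ℝ, E) 𝓘(ℝ, E).tangent
      (fun y ↦ (⟨y, V y⟩ : TangentBundle 𝓘(ℝ, E) M)) x) (α : Fin r) :
    MDifferentiableAt 𝓘(ℝ, E) 𝓘(ℝ, ℝ) (fun y ↦ inducedU J i ν α y (V y)) x :=
  (hν.mdiffAlongAt hx α).inner ((MDiffAlongAt.push hi.smooth hV).endField hJ.smooth)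

/-- P is defined pointwise by an adjoint, so regularity is obtained indirectly: i_*(PV) = J(i_*V) −
∑ u_α(V) N_α is differentiable along `i`, and this descends to PV because `i` is an immersion. -/
theorem mdifferentiableAt_inducedP (hdim : finrank ℝ E' = finrank ℝ E + r)
    (hJ : IsMetallicRiemannian p q J) (hi : IsIsometricImmersion E E' i)
    (hν : IsNormalFrame E i U ν) (hx : x ∈ U) {V : VField E M}
    (hV : MDifferentiableAt 𝓘(ℝ, E) 𝓘(ℝ, E).tangent
      (fun y ↦ (⟨y, V y⟩ : TangentBundle 𝓘(ℝ, E) M)) x) :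
    MDifferentiableAt 𝓘(ℝ, E) 𝓘(ℝ, E).tangent
      (fun y ↦ (⟨y, inducedP J i y (V y)⟩ : TangentBundle 𝓘(ℝ, E) M)) x := by
  refine mdifferentiableAt_of_push hi.smooth (hi.push_injective x) ?_
  have hid : MDifferentiableAt 𝓘(ℝ, E) 𝓘(ℝ, E') i x := (hi.smooth x).mdifferentiableAt (by simp)
  have h1 := (MDiffAlongAt.push hi.smooth hV).endField hJ.smooth
  have h2 : MDiffAlongAt E E' i (fun y ↦ ∑ α, (-inducedU J i ν α y (V y)) • ν α y) x :=
    .sum _ hid fun α _ ↦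
      .smul (mdifferentiableAt_inducedU hJ hi hν hx hV α).neg (hν.mdiffAlongAt hx α)
  refine (h1.add h2).congr ?_
  filter_upwards [hν.isOpen.mem_nhds hx] with y hy
  rw [decomposition_push hdim hi hν J hy]
  simp

/-- The derivative of `J (i_* V) = i_* (P V) + ∑ u_α(V) ν_α`. -/
theorem map_covAlong_push (hdim : finrank ℝ E' = finrank ℝ E + r)
    (hJ : IsMetallicRiemannian p q J) (hpar : IsParallel cov J)
    (hi : IsIsometricImmersion E E' i)
    (hν : IsNormalFrame E i U ν) (hx : x ∈ U) {V : VField E M}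
    (hV : MDifferentiableAt 𝓘(ℝ, E) 𝓘(ℝ, E).tangent
      (fun y ↦ (⟨y, V y⟩ : TangentBundle 𝓘(ℝ, E) M)) x) (v : TangentSpace 𝓘(ℝ, E) x) :
    J (i x) (covAlong cov i (fun y ↦ push i y (V y)) x v) =
      covAlong cov i (fun y ↦ push i y (inducedP J i y (V y))) x v
        + ∑ α, (mvfderiv 𝓘(ℝ, E) (fun y ↦ inducedU J i ν α y (V y)) x v • ν α x
          + inducedU J i ν α x (V x) • covAlong cov i (ν α) x v) := by
  have hid : MDifferentiableAt 𝓘(ℝ, E) 𝓘(ℝ, E') i x := (hi.smooth x).mdifferentiableAt (by simp)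
  have hu := mdifferentiableAt_inducedU hJ hi hν hx hV
  have hP := MDiffAlongAt.push hi.smooth (mdifferentiableAt_inducedP hdim hJ hi hν hx hV)
  have hs : ∀ α, MDiffAlongAt E E' i (fun y ↦ inducedU J i ν α y (V y) • ν α y) x := fun α ↦
    .smul (hu α) (hν.mdiffAlongAt hx α)
  rw [← covAlong_endField cov hJ.smooth hpar (MDiffAlongAt.push hi.smooth hV)]
  have hdec : ∀ᶠ y in nhds x, J (i y) (push i y (V y)) =
      push i y (inducedP J i y (V y)) + ∑ α, inducedU J i ν α y (V y) • ν α y := by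
    filter_upwards [hν.isOpen.mem_nhds hx] with y hy using decomposition_push hdim hi hν J hy _
  rw [covAlong_congr cov hdec, covAlong_add cov hP (.sum _ hid fun α _ ↦ hs α),
    covAlong_sum cov _ hid fun α _ ↦ hs α]
  congr 1
  exact Finset.sum_congr rfl fun α _ ↦ covAlong_smul cov (hu α) (hν.mdiffAlongAt hx α) v

/-- `(∇_v P) V = ∑ g(A_α v, V) ξ_α + u_α(V) A_α v`. -/
theorem inducedCov_inducedP (hdim : finrank ℝ E' = finrank ℝ E + r)
    (hJ : IsMetallicRiemannian p q J) (hcov : IsLeviCivita cov) (hpar : IsParallel cov J)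
    (hi : IsIsometricImmersion E E' i)
    (hν : IsNormalFrame E i U ν) (hx : x ∈ U) {V : VField E M}
    (hV : MDifferentiableAt 𝓘(ℝ, E) 𝓘(ℝ, E).tangent
      (fun y ↦ (⟨y, V y⟩ : TangentBundle 𝓘(ℝ, E) M)) x) (v : TangentSpace 𝓘(ℝ, E) x) :
    inducedCov cov i (fun y ↦ inducedP J i y (V y)) x v =
      inducedP J i x (inducedCov cov i V x v)
        + ∑ α, ((inner ℝ (shape cov i ν α x v) (V x) : ℝ) • inducedXi J i ν α x
          + (inner ℝ (V x) (inducedXi J i ν α x) : ℝ) • shape cov i ν α x v) := by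
  have h := map_covAlong_push hdim hJ hpar hi hν hx hV v
  rw [covAlong_push hdim hcov hi hν hx hV] at h
  have h' := congrArg (tangentPart (E := E) i x) h
  simp only [map_add, map_sum, map_smul, tangentPart_normal hν hx, smul_zero, zero_add,
    tangentPart_covAlong_normal, smul_neg, Finset.sum_neg_distrib, inducedU_apply hJ.compat] at h'
  rw [Finset.sum_add_distrib]
  -- The tangential parts of J(i_*∇_v V) and J N_α are P∇_v V and ξ_α by definition.
  have e : inducedP J i x (inducedCov cov i V x v)
      + ∑ α, (inner ℝ (shape cov i ν α x v) (V x) : ℝ) • inducedXi J i ν α x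
      = inducedCov cov i (fun y ↦ inducedP J i y (V y)) x v
        + -∑ α, (inner ℝ (V x) (inducedXi J i ν α x) : ℝ) • shape cov i ν α x v := h'
  rw [← add_assoc, e]
  abel

/-- The derivative of `u_β(V)`, from the normal component of `∇' J = 0`. -/
theorem mvfderiv_inducedU (hdim : finrank ℝ E' = finrank ℝ E + r)
    (hJ : IsMetallicRiemannian p q J) (hcov : IsLeviCivita cov) (hpar : IsParallel cov J)
    (hi : IsIsometricImmersion E E' i)
    (hν : IsNormalFrame E i U ν) (hx : x ∈ U) {V : VField E M}
    (hV : MDifferentiableAt 𝓘(ℝ, E) 𝓘(ℝ, E).tangent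
      (fun y ↦ (⟨y, V y⟩ : TangentBundle 𝓘(ℝ, E) M)) x) (v : TangentSpace 𝓘(ℝ, E) x) (β : Fin r) :
    mvfderiv 𝓘(ℝ, E) (fun y ↦ inducedU J i ν β y (V y)) x v =
      inducedU J i ν β x (inducedCov cov i V x v)
        + ∑ α, inner ℝ (shape cov i ν α x v) (V x) * inner ℝ (ν β x) (J (i x) (ν α x))
        - inner ℝ (shape cov i ν β x v) (inducedP J i x (V x))
        + ∑ α, normalCoeff cov i ν β α x v * inner ℝ (V x) (inducedXi J i ν α x) := by
  have h := map_covAlong_push hdim hJ hpar hi hν hx hV v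
  rw [covAlong_push hdim hcov hi hν hx hV] at h
  have h' := congrArg (fun z ↦ (inner ℝ (ν β x) z : ℝ)) h
  simp only [map_add, map_sum, map_smul, inner_add_right, inner_sum, real_inner_smul_right,
    Finset.sum_add_distrib, hν.orthonormal _ _ x hx, mul_ite, mul_one, mul_zero,
    Finset.sum_ite_eq, Finset.mem_univ, if_true, ← normalCoeff_apply hν hx,
    inducedU_apply hJ.compat,
    inner_normal_covAlong_push hcov hi hν hx (mdifferentiableAt_inducedP hdim hJ hi hν hx hV)] at h'
  have e : (inner ℝ (ν β x) (J (i x) (push i x (inducedCov cov i V x v))) : ℝ)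
    = inner ℝ (inducedCov cov i V x v) (inducedXi J i ν β x) := inducedU_apply hJ.compat β _
  -- Pairing with N_β produces l_αβ on the other side of the equation; antisymmetry absorbs the sign
  -- and gives l_βα.
  have hl : ∑ α, (inner ℝ (V x) (inducedXi J i ν α x) : ℝ) * normalCoeff cov i ν α β x v
      = -∑ α, normalCoeff cov i ν β α x v * inner ℝ (V x) (inducedXi J i ν α x) := by
    rw [← Finset.sum_neg_distrib]
    refine Finset.sum_congr rfl fun α _ ↦ ?_
    rw [normalCoeff_antisymm hcov hν hx α β]
    ring
  rw [hl, e] at h'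
  simp only [inducedU_apply hJ.compat]
  linarith

/-- The Nijenhuis torsion of the induced structure. -/
theorem nijenhuis_inducedP (hdim : finrank ℝ E' = finrank ℝ E + r)
    (hJ : IsMetallicRiemannian p q J) (hcov : IsLeviCivita cov) (hpar : IsParallel cov J)
    (hi : IsIsometricImmersion E E' i)
    (hν : IsNormalFrame E i U ν) (hx : x ∈ U) {X Y : VField E M}
    (hX : MDifferentiableAt 𝓘(ℝ, E) 𝓘(ℝ, E).tangent
      (fun y ↦ (⟨y, X y⟩ : TangentBundle 𝓘(ℝ, E) M)) x)
    (hY : MDifferentiableAt 𝓘(ℝ, E) 𝓘(ℝ, E).tangent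
      (fun y ↦ (⟨y, Y y⟩ : TangentBundle 𝓘(ℝ, E) M)) x) :
    nijenhuis (inducedP J i) X Y x =
      ∑ α, ((inner ℝ (X x) (inducedXi J i ν α x) : ℝ) • opB cov J i ν α x (Y x)
            - (inner ℝ (Y x) (inducedXi J i ν α x) : ℝ) • opB cov J i ν α x (X x)
            - (inner ℝ (opB cov J i ν α x (X x)) (Y x) : ℝ) • inducedXi J i ν α x) := by
  have hPX := mdifferentiableAt_inducedP hdim hJ hi hν hx hX
  have hPY := mdifferentiableAt_inducedP hdim hJ hi hν hx hY
  have hP := fun {V : VField E M} ↦ inducedCov_inducedP hdim hJ hcov hpar hi hν hx (V := V)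
  have ht := hcov.torsion_eq_zero
  rw [nijenhuis, inducedCov_sub ht hi hPX hPY, inducedCov_sub ht hi hX hY,
    inducedCov_sub ht hi hPX hY, inducedCov_sub ht hi hX hPY, hP hX, hP hX, hP hY, hP hY]
  have hA := inner_shape_comm hcov hi hν hx
  -- `h1` brings the coefficient of ξ_α to g((A_αP − PA_α)X, Y) = −g(B_αX, Y); `h2` cancels the Pξ_α
  -- terms.
  have h1 : ∀ α, (inner ℝ (shape cov i ν α x (inducedP J i x (Y x))) (X x) : ℝ)
      = inner ℝ (inducedP J i x (shape cov i ν α x (X x))) (Y x) := fun α ↦ by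
    rw [hA, real_inner_comm, inner_inducedP_left hJ.compat]
  have h2 : ∀ α, (inner ℝ (shape cov i ν α x (Y x)) (X x) : ℝ)
      = inner ℝ (shape cov i ν α x (X x)) (Y x) := fun α ↦ by rw [hA, real_inner_comm]
  simp only [map_add, map_sub, map_sum, map_smul, h1, h2, opB, sub_apply,
    ContinuousLinearMap.comp_apply, smul_sub, sub_smul, inner_sub_left, Finset.sum_sub_distrib,
    Finset.sum_add_distrib]
  abel

/-- Antisymmetrise the derivative of u_α. The terms in ∇ cancel u_α([X,Y]), those in a_αβ cancel by
symmetry of the shape operators, and −g(A_αX, PY) + g(A_αY, PX) = −g(B_αX, Y) by symmetry of P and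
A_α. -/
theorem two_mul_extDer_inducedU (hdim : finrank ℝ E' = finrank ℝ E + r)
    (hJ : IsMetallicRiemannian p q J) (hcov : IsLeviCivita cov) (hpar : IsParallel cov J)
    (hi : IsIsometricImmersion E E' i)
    (hν : IsNormalFrame E i U ν) (hx : x ∈ U) {X Y : VField E M}
    (hX : MDifferentiableAt 𝓘(ℝ, E) 𝓘(ℝ, E).tangent
      (fun y ↦ (⟨y, X y⟩ : TangentBundle 𝓘(ℝ, E) M)) x)
    (hY : MDifferentiableAt 𝓘(ℝ, E) 𝓘(ℝ, E).tangent
      (fun y ↦ (⟨y, Y y⟩ : TangentBundle 𝓘(ℝ, E) M)) x) (α : Fin r) :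
    2 * extDer (inducedU J i ν α) X Y x =
      -inner ℝ (opB cov J i ν α x (X x)) (Y x)
        + ∑ β, (normalCoeff cov i ν α β x (X x) * inner ℝ (Y x) (inducedXi J i ν β x)
              - normalCoeff cov i ν α β x (Y x) * inner ℝ (X x) (inducedXi J i ν β x)) := by
  have hd := fun {V : VField E M} ↦ mvfderiv_inducedU hdim hJ hcov hpar hi hν hx (V := V)
  have hA := inner_shape_comm hcov hi hν hx
  have hsymm : ∑ β, (inner ℝ (shape cov i ν β x (X x)) (Y x) : ℝ)
        * inner ℝ (ν α x) (J (i x) (ν β x))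
      = ∑ β, inner ℝ (shape cov i ν β x (Y x)) (X x) * inner ℝ (ν α x) (J (i x) (ν β x)) :=
    Finset.sum_congr rfl fun β _ ↦ by rw [hA, real_inner_comm]
  have h1 : (inner ℝ (shape cov i ν α x (Y x)) (inducedP J i x (X x)) : ℝ)
      = inner ℝ (shape cov i ν α x (inducedP J i x (X x))) (Y x) := by
    rw [hA, real_inner_comm]
  have h2 : (inner ℝ (shape cov i ν α x (X x)) (inducedP J i x (Y x)) : ℝ)
      = inner ℝ (inducedP J i x (shape cov i ν α x (X x))) (Y x) :=
    (inner_inducedP_left hJ.compat _ _).symm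
  rw [extDer, hd hX, hd hY, inducedCov_sub hcov.torsion_eq_zero hi hX hY, map_sub, hsymm, h1, h2,
    Finset.sum_sub_distrib, opB]
  simp only [sub_apply, ContinuousLinearMap.comp_apply, inner_sub_left]
  ring

end StructureEquations

end MetallicSubmanifold

end

theorem mainTheorem2
    {E : Type*} [NormedAddCommGroup E] [NormedSpace ℝ E] [FiniteDimensional ℝ E]
    {M : Type*} [TopologicalSpace M] [ChartedSpace E M] [IsManifold 𝓘(ℝ, E) ∞ M]
    [RiemannianBundle (fun x : M ↦ TangentSpace 𝓘(ℝ, E) x)]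
    [IsContMDiffRiemannianBundle 𝓘(ℝ, E) ∞ E (fun x : M ↦ TangentSpace 𝓘(ℝ, E) x)]
    {E' : Type*} [NormedAddCommGroup E'] [NormedSpace ℝ E'] [FiniteDimensional ℝ E']
    {M' : Type*} [TopologicalSpace M'] [ChartedSpace E' M'] [IsManifold 𝓘(ℝ, E') ∞ M']
    [RiemannianBundle (fun y : M' ↦ TangentSpace 𝓘(ℝ, E') y)]
    [IsContMDiffRiemannianBundle 𝓘(ℝ, E') ∞ E' (fun y : M' ↦ TangentSpace 𝓘(ℝ, E') y)]
    (r : ℕ) (hdim : finrank ℝ E' = finrank ℝ E + r)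
    (p q : ℕ) (J : MetallicSubmanifold.EndField E' M')
    (hJ : MetallicSubmanifold.IsMetallicRiemannian p q J)
    (cov : CovariantDerivative 𝓘(ℝ, E') E' (fun y : M' ↦ TangentSpace 𝓘(ℝ, E') y))
    (hcov : MetallicSubmanifold.IsLeviCivita cov)
    (hpar : MetallicSubmanifold.IsParallel cov J)
    (i : M → M') (hi : MetallicSubmanifold.IsIsometricImmersion E E' i)
    (U : Set M) (ν : Fin r → MetallicSubmanifold.VFieldAlong E' i)
    (hν : MetallicSubmanifold.IsNormalFrame E i U ν)
    (X Y : MetallicSubmanifold.VField E M)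
    (hX : MetallicSubmanifold.SmoothVFieldOn X U)
    (hY : MetallicSubmanifold.SmoothVFieldOn Y U)
    (x : M) (hx : x ∈ U) :
    MetallicSubmanifold.nijenhuis (MetallicSubmanifold.inducedP J i) X Y x =
        ∑ α, (inner ℝ (X x) (MetallicSubmanifold.inducedXi J i ν α x) •
              MetallicSubmanifold.opB cov J i ν α x (Y x)
            - inner ℝ (Y x) (MetallicSubmanifold.inducedXi J i ν α x) •
              MetallicSubmanifold.opB cov J i ν α x (X x)
            - inner ℝ (MetallicSubmanifold.opB cov J i ν α x (X x)) (Y x) •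
              MetallicSubmanifold.inducedXi J i ν α x) ∧
    ∀ α, 2 * MetallicSubmanifold.extDer (MetallicSubmanifold.inducedU J i ν α) X Y x =
        - inner ℝ (MetallicSubmanifold.opB cov J i ν α x (X x)) (Y x)
        + ∑ β, (MetallicSubmanifold.normalCoeff cov i ν α β x (X x) *
                inner ℝ (Y x) (MetallicSubmanifold.inducedXi J i ν β x)
              - MetallicSubmanifold.normalCoeff cov i ν α β x (Y x) *
                inner ℝ (X x) (MetallicSubmanifold.inducedXi J i ν β x)) := by
  -- U is open, so smoothness on U yields differentiability at x, the only regularity of X and Y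
  -- that the identities require.
  have hXd := (hX.contMDiffAt (hν.isOpen.mem_nhds hx)).mdifferentiableAt (by simp)
  have hYd := (hY.contMDiffAt (hν.isOpen.mem_nhds hx)).mdifferentiableAt (by simp)
  exact ⟨MetallicSubmanifold.nijenhuis_inducedP hdim hJ hcov hpar hi hν hx hXd hYd,
    MetallicSubmanifold.two_mul_extDer_inducedU hdim hJ hcov hpar hi hν hx hXd hYd⟩
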